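/- **Setting.** Manifolds are smooth, finite dimensional, Hausdorff and second countable. Let $G$ be a Lie group with Lie algebra $\mathfrak g$, acting smoothly, freely and properly from the right on manifolds $P$ and $Q$ (write $\Psi_g(m)=mg$). For $\xi\in\mathfrak g$ let $\xi_P,\xi_Q$ be the fundamental vector fields, $\xi_Q(q)=\frac{d}{dt}\big|_{0}\,q\exp(t\xi)$, and let $\langle \mathrm{Ad}^*_g\mu,\xi\rangle=\langle\mu,\mathrm{Ad}_g\xi\rangle$. Let $\pi:Q\to Q/G$ be the projection, $Q/G$ carrying the smooth structure for which $\pi$ is a submersion. For a map $f:X\to M$ into a manifold put $T_XM=TM\times_MX$, $T^*_XM=T^*M\times_MX$. For a function $L$ on $T_XM$ that is differentiable along the fibres over $X$, its fibre derivative $\mathbb FL:T_XM\to T^*_XM$ and energy $E_L$ are $$\mathbb FL(v,x)=(\alpha,x),\quad \langle\alpha,w\rangle=\tfrac{d}{du}\Big|_{u=0}L(v+uw,x),\qquad E_L(v,x)=\langle\mathbb FL(v,x),(v,x)\rangle-L(v,x).$$ Let $(\epsilon:P\to Q,L,\mathcal B)$ be a $G$-invariant magnetic Lagrangian system: $\epsilon$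 is a smooth $G$-equivariant fibre bundle, $\mathcal B$ a closed $G$-invariant $2$-form on $P$, and $L$ a smooth function on $T_PQ$ invariant under $(v_q,p)\mapsto(T\Psi_g(v_q),pg)$. The group acts on $T^*_PQ$ by $(\alpha_q,p)\mapsto(T^*\Psi_{g^{-1}}(\alpha_q),pg)$. Let $\delta:P\to\mathfrak g^*$ be smooth with $i_{\xi_P}\mathcal B=d\langle\delta,\xi\rangle$ for all $\xi\in\mathfrak g$. Define $$\langle J_\delta(\alpha_q,p),\xi\rangle=\langle\alpha_q,\xi_Q(q)\rangle-\langle\delta(p),\xi\rangle,\qquad J_{L,\delta}=J_\delta\circ\mathbb FL .$$ Assume that $L$ is $G$-regular: for every $(v_q,p)\in T_PQ$ the map $\mathfrak g\to\mathfrak g^*$, $\xi\mapsto J_{L,\delta}(v_q+\xi_Q(q),p)$ is a diffeomorphism. Fix $\mu\in\mathfrak g^*$ and a principal connection $\mathcal A$ on $\pi:Q\to Q/G$. With $\sigma_\delta(g)=\delta(pg^{-1})-\mathrm{Ad}^*_{g^{-1}}\delta(p)$ let $G_\mu$ be the group of all $g\in G$ such that $\mu=\mathrm{Ad}^*_g\mu-\sigma_\delta(g^{-1})$,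 where $\sigma_\delta$ is computed at every $p\in P$ (for connected $P$ it does not depend on $p$). The map $P/G_\mu\to Q/G$ induced by $\epsilon$ defines $T_{P/G_\mu}(Q/G)$ and $T^*_{P/G_\mu}(Q/G)$. Let $i_\mu:J_{L,\delta}^{-1}(\mu)\to T_PQ$ be the inclusion, $\pi_\mu:J_{L,\delta}^{-1}(\mu)\to J_{L,\delta}^{-1}(\mu)/G_\mu$ the projection, and $$\Pi_\mu:J_{L,\delta}^{-1}(\mu)/G_\mu\to T_{P/G_\mu}(Q/G),\qquad [(v_q,p)]\mapsto(T\pi(v_q),[p]).$$ Let $[(\mathbb FL)_\mu]:J_{L,\delta}^{-1}(\mu)/G_\mu\to J_\delta^{-1}(\mu)/G_\mu$ be the map induced by $\mathbb FL$. Let $V^0_P\pi\subset T^*_PQ$ consist of the $(\alpha_q,p)$ with $\langle\alpha_q,\xi_Q(q)\rangle=0$ for all $\xi$, and let $[\phi^{\mathcal A}_\mu]:J_\delta^{-1}(\mu)/G_\mu\to V^0_P\pi/G_\mu$ be induced by the shift map $$\phi^{\mathcal A}_\mu(\alpha_q,p)=\big(\alpha_q-\langle\mu+\delta(p),\mathcal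 A(q)\rangle,\;p\big).$$ **Statement.** The map $T^*_{P/G_\mu}(Q/G)\to V^0_P\pi/G_\mu$, $(\beta,[p])\mapsto[(\beta\circ T_{\epsilon(p)}\pi,p)]$, is a bijection; identify the two sets by it. The map $\Pi_\mu$ is a bijection; let $\Delta_\mu=\Pi_\mu^{-1}$. Let the Routhian $\tilde L:T_{P/G_\mu}(Q/G)\to\mathbb R$ be the composition with $\Delta_\mu$ of the function on $J_{L,\delta}^{-1}(\mu)/G_\mu$ induced by $$(v_q,p)\mapsto L(v_q,p)-\langle\mu+\delta(p),\mathcal A(q)(v_q)\rangle .$$ Then $\tilde L$ is differentiable along the fibres over $P/G_\mu$, and 1. $\mathbb F\tilde L=[\phi^{\mathcal A}_\mu]\circ[(\mathbb FL)_\mu]\circ\Delta_\mu$; 2. $(\Pi_\mu\circ\pi_\mu)^*E_{\tilde L}=i_\mu^*E_L$. -/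

import Mathlib

open scoped Manifold ContDiff RightActions

noncomputable section

set_option linter.unusedSectionVars false

namespace Routh

/-! ### Fibred products `TM ×_M X` and `T*M ×_M X`, fibre derivatives, energies

Manifolds are modelled on finite dimensional real normed spaces `E`, with the model with corners
`𝓘(ℝ, E)`, so they have no boundary. Mathlib's `TangentSpace 𝓘(ℝ, E) x` is by definition the model
space `E` (read in the preferred chart at `x`). -/

section Fibred

variable {E M X : Type*} [NormedAddCommGroup E] [NormedSpace ℝ E]
  [TopologicalSpace M] [ChartedSpace E M]

/-- The fibred product `T_X M = TM ×_M X` of the tangent bundle of `M` with a map `f : X → M`: the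
total space of the pullback bundle, whose points are pairs of `x : X` and `v ∈ T_{f x} M`. -/
abbrev FibredTangent (E : Type*) {M X : Type*} [NormedAddCommGroup E] [NormedSpace ℝ E]
    [TopologicalSpace M] [ChartedSpace E M] (f : X → M) : Type _ :=
  Bundle.TotalSpace E (f *ᵖ (TangentSpace 𝓘(ℝ, E) : M → Type _))

/-- The point `(v, x)` of `TM ×_M X`. -/
def FibredTangent.mk (f : X → M) (x : X) (v : TangentSpace 𝓘(ℝ, E) (f x)) : FibredTangent E f :=
  ⟨x, v⟩

/-- The tangent vector `v ∈ T_{f x} M` of a point `(v, x)` of `TM ×_M X`. -/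
def FibredTangent.vec {f : X → M} (z : FibredTangent E f) : TangentSpace 𝓘(ℝ, E) (f z.proj) :=
  z.snd

/-- The fibred product `T*_X M = T*M ×_M X`: pairs of `x : X` and a covector `α ∈ T*_{f x} M`. -/
structure FibredCotangent (E : Type*) {M X : Type*} [NormedAddCommGroup E] [NormedSpace ℝ E]
    [TopologicalSpace M] [ChartedSpace E M] (f : X → M) where
  proj : X
  cov : TangentSpace 𝓘(ℝ, E) (f proj) →L[ℝ] ℝ

/-- The Legendre transform (fibre derivative) `𝔽L : T_X M → T*_X M` of a function `L` on `T_X M`: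
`⟨𝔽L (v, x), w⟩ = d/du L (v + u w, x)` at `u = 0`. -/
def fibreDerivative {f : X → M} (L : FibredTangent E f → ℝ) (z : FibredTangent E f) :
    FibredCotangent E f where
  proj := z.proj
  cov := fderiv ℝ (fun v : TangentSpace 𝓘(ℝ, E) (f z.proj) => L (FibredTangent.mk f z.proj v)) z.vec

/-- `L` is differentiable along the fibres of `T_X M → X`. -/
def FibrewiseDifferentiable {f : X → M} (L : FibredTangent E f → ℝ) : Prop :=
  ∀ x : X, Differentiable ℝ
    (fun v : TangentSpace 𝓘(ℝ, E) (f x) => L (FibredTangent.mk f x v))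

/-- The energy `E_L (v, x) = ⟨𝔽L (v, x), (v, x)⟩ - L (v, x)`. -/
def energy {f : X → M} (L : FibredTangent E f → ℝ) (z : FibredTangent E f) : ℝ :=
  (fibreDerivative L z).cov z.vec - L z

end Fibred

/-! ### Differential 2-forms -/

section Forms

variable {E M : Type*} [NormedAddCommGroup E] [NormedSpace ℝ E]
  [TopologicalSpace M] [ChartedSpace E M]

/-- A field of alternating bilinear forms on the tangent spaces of `M`. -/
abbrev TwoForm (E M : Type*) [NormedAddCommGroup E] [NormedSpace ℝ E]
    [TopologicalSpace M] [ChartedSpace E M] : Type _ :=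
  ∀ x : M, TangentSpace 𝓘(ℝ, E) x [⋀^Fin 2]→L[ℝ] ℝ

/-- The coordinate expression of a 2-form in the chart at `x₀`: its pullback under the inverse of
the chart. -/
def TwoForm.inChart (B : TwoForm E M) (x₀ : M) (y : E) : E [⋀^Fin 2]→L[ℝ] ℝ :=
  (B ((extChartAt 𝓘(ℝ, E) x₀).symm y)).compContinuousLinearMap
    (mfderiv 𝓘(ℝ, E) 𝓘(ℝ, E) (extChartAt 𝓘(ℝ, E) x₀).symm y)

/-- `B` is smooth: its coordinate expressions are. -/
def TwoForm.IsSmooth (B : TwoForm E M) : Prop :=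
  ∀ x₀ : M, ContDiffOn ℝ ∞ (B.inChart x₀) (extChartAt 𝓘(ℝ, E) x₀).target

/-- `B` is closed: `dB = 0` in every chart. -/
def TwoForm.IsClosed (B : TwoForm E M) : Prop :=
  ∀ x₀ : M, ∀ y ∈ (extChartAt 𝓘(ℝ, E) x₀).target, extDeriv (B.inChart x₀) y = 0

end Forms

/-! ### Right actions of Lie groups

A right action of `G` on `M` is a `MulAction` of the opposite group, and `m <• g` is the point
`Ψ_g (m) = m g`. -/

section Actions

variable {EG G E M : Type*} [NormedAddCommGroup EG] [NormedSpace ℝ EG]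
  [NormedAddCommGroup E] [NormedSpace ℝ E]
  [TopologicalSpace G] [ChartedSpace EG G] [Group G]
  [TopologicalSpace M] [ChartedSpace E M] [MulAction Gᵐᵒᵖ M]

/-- The right action of the Lie group `G` on `M` is smooth, free and proper. -/
structure IsFreeProperAction (EG G E M : Type*) [NormedAddCommGroup EG] [NormedSpace ℝ EG]
    [NormedAddCommGroup E] [NormedSpace ℝ E]
    [TopologicalSpace G] [ChartedSpace EG G] [Group G]
    [TopologicalSpace M] [ChartedSpace E M] [MulAction Gᵐᵒᵖ M] : Prop where
  smooth : ContMDiff (𝓘(ℝ, E).prod 𝓘(ℝ, EG)) 𝓘(ℝ, E) ∞ (fun z : M × G => z.1 <• z.2)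
  free : ∀ (g : G) (m : M), m <• g = m → g = 1
  proper : IsProperMap (fun z : M × G => (z.1 <• z.2, z.1))

/-- The Lie algebra `𝔤 = T_1 G`, as a normed space (the tangent space at `1` is the model space). -/
abbrev LieAlg (EG G : Type*) [NormedAddCommGroup EG] [NormedSpace ℝ EG]
    [TopologicalSpace G] [ChartedSpace EG G] [Group G] : Type _ := EG

/-- The dual `𝔤*` of the Lie algebra. -/
abbrev LieAlgDual (EG G : Type*) [NormedAddCommGroup EG] [NormedSpace ℝ EG]
    [TopologicalSpace G] [ChartedSpace EG G] [Group G] : Type _ := LieAlg EG G →L[ℝ] ℝ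

/-- The adjoint action `Ad_g : 𝔤 → 𝔤`, the derivative at `1` of `h ↦ g h g⁻¹`. -/
def Ad (EG : Type*) {G : Type*} [NormedAddCommGroup EG] [NormedSpace ℝ EG]
    [TopologicalSpace G] [ChartedSpace EG G] [Group G] (g : G) : LieAlg EG G →L[ℝ] LieAlg EG G :=
  mfderiv 𝓘(ℝ, EG) 𝓘(ℝ, EG) (fun h : G => g * h * g⁻¹) 1

/-- The coadjoint action: `⟨Ad*_g μ, ξ⟩ = ⟨μ, Ad_g ξ⟩`. -/
def coAd (g : G) (μ : LieAlgDual EG G) : LieAlgDual EG G := μ.comp (Ad EG g)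

/-- The infinitesimal action `ψ_m : 𝔤 → T_m M`, `ψ_m ξ = ξ_M (m)`: the derivative at `1` of
`g ↦ m g`. Thus `ξ_M (m)` is the velocity at `t = 0` of `m exp (t ξ)`. -/
def infAction (EG G : Type*) {E M : Type*} [NormedAddCommGroup EG] [NormedSpace ℝ EG]
    [NormedAddCommGroup E] [NormedSpace ℝ E] [TopologicalSpace G] [ChartedSpace EG G] [Group G]
    [TopologicalSpace M] [ChartedSpace E M] [MulAction Gᵐᵒᵖ M] (m : M) : LieAlg EG G →L[ℝ] TangentSpace 𝓘(ℝ, E) m :=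
  mfderiv 𝓘(ℝ, EG) 𝓘(ℝ, E) (fun g : G => m <• g) 1

/-- The tangent map `T_m Ψ_g : T_m M → T_{m g} M`. -/
def tangentAct (g : G) (m : M) : TangentSpace 𝓘(ℝ, E) m →L[ℝ] TangentSpace 𝓘(ℝ, E) (m <• g) :=
  mfderiv 𝓘(ℝ, E) 𝓘(ℝ, E) (fun x : M => x <• g) m

/-- The orbit space `M / G`. -/
abbrev OrbitSpace (G M : Type*) [Group G] [MulAction Gᵐᵒᵖ M] : Type _ :=
  MulAction.orbitRel.Quotient Gᵐᵒᵖ M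

/-- The projection `π : M → M / G`. -/
def orbitProj (G : Type*) {M : Type*} [Group G] [MulAction Gᵐᵒᵖ M] (m : M) : OrbitSpace G M :=
  Quotient.mk (MulAction.orbitRel Gᵐᵒᵖ M) m

/-- The smooth structure on `M / G` is the quotient structure, that is, the (unique) one for which
the projection `M → M / G` is a smooth submersion. -/
structure IsQuotientStructure (G E M EB : Type*) [Group G]
    [NormedAddCommGroup E] [NormedSpace ℝ E] [NormedAddCommGroup EB] [NormedSpace ℝ EB]
    [TopologicalSpace M] [ChartedSpace E M] [MulAction Gᵐᵒᵖ M]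
    [ChartedSpace EB (OrbitSpace G M)] : Prop where
  smooth : ContMDiff 𝓘(ℝ, E) 𝓘(ℝ, EB) ∞ (orbitProj G : M → OrbitSpace G M)
  submersion : ∀ m : M,
    Function.Surjective (mfderiv 𝓘(ℝ, E) 𝓘(ℝ, EB) (orbitProj G : M → OrbitSpace G M) m)

/-- A principal connection on `M → M / G`: a smooth `𝔤`-valued 1-form `𝒜` with
`Ψ_g^* 𝒜 = Ad_{g⁻¹} ∘ 𝒜` and `𝒜 (ξ_M) = ξ`. -/
structure PrincipalConnection (EG G E M : Type*) [NormedAddCommGroup EG] [NormedSpace ℝ EG]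
    [NormedAddCommGroup E] [NormedSpace ℝ E]
    [TopologicalSpace G] [ChartedSpace EG G] [Group G]
    [TopologicalSpace M] [ChartedSpace E M] [IsManifold 𝓘(ℝ, E) 1 M] [MulAction Gᵐᵒᵖ M] where
  form : ∀ m : M, TangentSpace 𝓘(ℝ, E) m →L[ℝ] LieAlg EG G
  smooth : ContMDiff 𝓘(ℝ, E).tangent 𝓘(ℝ, EG) ∞
    (fun v : TangentBundle 𝓘(ℝ, E) M => form v.proj v.snd)
  equivariant : ∀ (g : G) (m : M) (v : TangentSpace 𝓘(ℝ, E) m),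
    form (m <• g) (tangentAct g m v) = Ad EG g⁻¹ (form m v)
  vertical : ∀ (m : M) (ξ : LieAlg EG G), form m (infAction EG G m ξ) = ξ

/-! Functoriality of the tangent maps. -/

theorem IsFreeProperAction.mdifferentiable (hM : IsFreeProperAction EG G E M) (g : G) :
    MDifferentiable 𝓘(ℝ, E) 𝓘(ℝ, E) (fun x : M => x <• g) := by
  have h : ContMDiff 𝓘(ℝ, E) 𝓘(ℝ, E) ∞ (fun x : M => x <• g) :=
    hM.smooth.comp (f := fun x : M => (x, g)) (contMDiff_id.prodMk contMDiff_const)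
  exact h.mdifferentiable (by simp)

theorem IsFreeProperAction.mdifferentiable_orbit (hM : IsFreeProperAction EG G E M) (m : M) :
    MDifferentiable 𝓘(ℝ, EG) 𝓘(ℝ, E) (fun g : G => m <• g) := by
  have h : ContMDiff 𝓘(ℝ, EG) 𝓘(ℝ, E) ∞ (fun g : G => m <• g) :=
    hM.smooth.comp (f := fun g : G => (m, g)) (contMDiff_const.prodMk contMDiff_id)
  exact h.mdifferentiable (by simp)

theorem tangentAct_one (m : M) (v : E) : (tangentAct (E := E) (1 : G) m v : E) = v := by
  have h : (fun x : M => x <• (1 : G)) = id := by funext x; simp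
  unfold tangentAct
  rw [h]
  exact congrArg (fun T : E →L[ℝ] E => T v) (mfderiv_id (I := 𝓘(ℝ, E)) (x := m))

theorem tangentAct_mul (hM : IsFreeProperAction EG G E M) (g h : G) (m : M) (v : E) :
    (tangentAct (E := E) (g * h) m v : E) =
      tangentAct (E := E) h (m <• g) (tangentAct (E := E) g m v) := by
  have h1 : (fun x : M => x <• (g * h)) = (fun x : M => x <• h) ∘ (fun x : M => x <• g) := by
    funext x; simp [mul_smul]
  unfold tangentAct
  rw [h1]
  exact congrArg (fun T : E →L[ℝ] E => T v)
    (mfderiv_comp m (hM.mdifferentiable h (m <• g)) (hM.mdifferentiable g m))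

theorem orbitProj_act (g : G) (m : M) : orbitProj G (m <• g) = orbitProj G m :=
  Quotient.sound ⟨MulOpposite.op g, rfl⟩

theorem mfderiv_orbitProj_tangentAct {EB : Type*} [NormedAddCommGroup EB] [NormedSpace ℝ EB]
    [ChartedSpace EB (OrbitSpace G M)] (hM : IsFreeProperAction EG G E M)
    (hπ : IsQuotientStructure G E M EB) (g : G) (m : M) (v : E) :
    (mfderiv 𝓘(ℝ, E) 𝓘(ℝ, EB) (orbitProj G : M → OrbitSpace G M) (m <• g)
      (tangentAct (E := E) g m v) : EB) =
    mfderiv 𝓘(ℝ, E) 𝓘(ℝ, EB) (orbitProj G : M → OrbitSpace G M) m v := by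
  have h1 : (orbitProj G : M → OrbitSpace G M) =
      (orbitProj G : M → OrbitSpace G M) ∘ (fun x : M => x <• g) := by
    funext x; exact (orbitProj_act g x).symm
  have h2 := mfderiv_comp m ((hπ.smooth.mdifferentiable (by simp)) (m <• g))
    (hM.mdifferentiable g m)
  rw [← h1] at h2
  exact (congrArg (fun T : E →L[ℝ] EB => T v) h2).symm

theorem mfderiv_orbitProj_infAction {EB : Type*} [NormedAddCommGroup EB] [NormedSpace ℝ EB]
    [ChartedSpace EB (OrbitSpace G M)] (hM : IsFreeProperAction EG G E M)
    (hπ : IsQuotientStructure G E M EB) (m : M) (ξ : LieAlg EG G) :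
    (mfderiv 𝓘(ℝ, E) 𝓘(ℝ, EB) (orbitProj G : M → OrbitSpace G M) m
      (infAction EG G m ξ : E) : EB) = 0 := by
  have h1 : (orbitProj G : M → OrbitSpace G M) ∘ (fun g : G => m <• g) =
      fun _ => orbitProj G m := by
    funext g; exact orbitProj_act g m
  have h2 := mfderiv_comp (g := (orbitProj G : M → OrbitSpace G M)) (f := fun g : G => m <• g)
    (1 : G) ((hπ.smooth.mdifferentiable (by simp)) (m <• (1 : G)))
    (hM.mdifferentiable_orbit m 1)
  rw [h1, mfderiv_const] at h2
  have h3 : m <• (1 : G) = m := by simp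
  have h4 := congrArg (fun T : EG →L[ℝ] EB => T ξ) h2
  have key : ∀ m' : M, m' = m →
      (mfderiv 𝓘(ℝ, E) 𝓘(ℝ, EB) (orbitProj G : M → OrbitSpace G M) m'
        (infAction EG G m ξ : E) : EB) =
      (mfderiv 𝓘(ℝ, E) 𝓘(ℝ, EB) (orbitProj G : M → OrbitSpace G M) m
        (infAction EG G m ξ : E) : EB) := by
    rintro _ rfl; rfl
  rw [← key _ h3]
  exact h4.symm

theorem Ad_one (ξ : LieAlg EG G) : Ad EG (1 : G) ξ = ξ := by
  have h : (fun h : G => (1 : G) * h * (1 : G)⁻¹) = id := by funext x; simp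
  unfold Ad
  rw [h]
  exact congrArg (fun T : EG →L[ℝ] EG => T ξ) (mfderiv_id (I := 𝓘(ℝ, EG)) (x := (1 : G)))

theorem Ad_mul [LieGroup 𝓘(ℝ, EG) ∞ G] (g h : G) (ξ : LieAlg EG G) :
    Ad EG (g * h) ξ = Ad EG g (Ad EG h ξ) := by
  have hd : ∀ a : G, MDifferentiable 𝓘(ℝ, EG) 𝓘(ℝ, EG) (fun x : G => a * x * a⁻¹) := fun a =>
    ContMDiff.mdifferentiable (n := ∞)
      ((contMDiff_const.mul contMDiff_id).mul contMDiff_const) (by simp)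
  have h1 : (fun x : G => g * h * x * (g * h)⁻¹) =
      (fun x : G => g * x * g⁻¹) ∘ (fun x : G => h * x * h⁻¹) := by
    funext x; simp [mul_assoc]
  unfold Ad
  rw [h1]
  have h2 := mfderiv_comp (1 : G) (hd g (h * 1 * h⁻¹)) (hd h 1)
  have h3 := congrArg (fun T : EG →L[ℝ] EG => T ξ) h2
  have key : ∀ a : G, a = 1 → ∀ v : EG,
      (mfderiv 𝓘(ℝ, EG) 𝓘(ℝ, EG) (fun x : G => g * x * g⁻¹) a v : EG) =
      (mfderiv 𝓘(ℝ, EG) 𝓘(ℝ, EG) (fun x : G => g * x * g⁻¹) 1 v : EG) := by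
    rintro _ rfl v; rfl
  exact Eq.trans h3 (key (h * 1 * h⁻¹) (by simp) _)

end Actions

/-! ### Magnetic Lagrangian systems -/

section Systems

/-- `ε : P → Q` is a smooth fibre bundle with typical fibre `F`. -/
def IsSmoothFibreBundle (EP EQ EF F : Type*) {P Q : Type*}
    [NormedAddCommGroup EP] [NormedSpace ℝ EP] [NormedAddCommGroup EQ] [NormedSpace ℝ EQ]
    [NormedAddCommGroup EF] [NormedSpace ℝ EF]
    [TopologicalSpace P] [ChartedSpace EP P] [TopologicalSpace Q] [ChartedSpace EQ Q]
    [TopologicalSpace F] [ChartedSpace EF F] (ε : P → Q) : Prop :=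
  ∀ q : Q, ∃ e : Bundle.Trivialization F ε, q ∈ e.baseSet ∧
    ContMDiffOn 𝓘(ℝ, EP) (𝓘(ℝ, EQ).prod 𝓘(ℝ, EF)) ∞ e e.source ∧
    ContMDiffOn (𝓘(ℝ, EQ).prod 𝓘(ℝ, EF)) 𝓘(ℝ, EP) ∞ e.toOpenPartialHomeomorph.symm e.target

/-- A magnetic Lagrangian system: a smooth fibre bundle `ε : P → Q`, a smooth Lagrangian `L` on
`T_P Q = TQ ×_Q P` and a smooth closed 2-form `B` on `P`. -/
structure MagneticSystem (EP EQ EF P Q F : Type*)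
    [NormedAddCommGroup EP] [NormedSpace ℝ EP] [NormedAddCommGroup EQ] [NormedSpace ℝ EQ]
    [NormedAddCommGroup EF] [NormedSpace ℝ EF]
    [TopologicalSpace P] [ChartedSpace EP P]
    [TopologicalSpace Q] [ChartedSpace EQ Q] [IsManifold 𝓘(ℝ, EQ) ∞ Q]
    [TopologicalSpace F] [ChartedSpace EF F] where
  ε : C^∞⟮𝓘(ℝ, EP), P; 𝓘(ℝ, EQ), Q⟯
  bundle : IsSmoothFibreBundle EP EQ EF F ε
  L : FibredTangent EQ (ε : P → Q) → ℝ
  L_smooth : ContMDiff (𝓘(ℝ, EP).prod 𝓘(ℝ, EQ)) 𝓘(ℝ, ℝ) ∞ L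
  B : TwoForm EP P
  B_smooth : B.IsSmooth
  B_closed : B.IsClosed

/-- The lifted action on `T_P Q`: `Ψ_g (v, p) = (TΨ_g v, p g)`. It is used for equivariant `ε`, when
`ε (p g) = ε (p) g`, so that `TΨ_g v` is tangent at `ε (p g)`. -/
def tangentLift {G EQ P Q : Type*} [Group G] [NormedAddCommGroup EQ] [NormedSpace ℝ EQ]
    [TopologicalSpace Q] [ChartedSpace EQ Q] [MulAction Gᵐᵒᵖ P] [MulAction Gᵐᵒᵖ Q] {ε : P → Q}
    (g : G) (x : FibredTangent EQ ε) : FibredTangent EQ ε :=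
  FibredTangent.mk ε (x.proj <• g) (tangentAct (E := EQ) g (ε x.proj) x.vec : EQ)

/-- The lifted action on `T*_P Q`: `Ψ_g (α, p) = (T*Ψ_{g⁻¹} α, p g)`, for equivariant `ε`. -/
def cotangentLift {G EQ P Q : Type*} [Group G] [NormedAddCommGroup EQ] [NormedSpace ℝ EQ]
    [TopologicalSpace Q] [ChartedSpace EQ Q] [MulAction Gᵐᵒᵖ P] [MulAction Gᵐᵒᵖ Q] {ε : P → Q}
    (g : G) (α : FibredCotangent EQ ε) : FibredCotangent EQ ε where
  proj := α.proj <• g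
  cov := (α.cov : EQ →L[ℝ] ℝ).comp
    (tangentAct (E := EQ) g⁻¹ (ε (α.proj <• g)) : EQ →L[ℝ] EQ)

/-- A `G`-invariant magnetic Lagrangian system: `G` acts freely and properly on `P` and `Q`, `ε` is
equivariant, and `B` and `L` are invariant. -/
structure InvariantSystem (EG G EP EQ EF P Q F : Type*)
    [NormedAddCommGroup EG] [NormedSpace ℝ EG]
    [NormedAddCommGroup EP] [NormedSpace ℝ EP] [NormedAddCommGroup EQ] [NormedSpace ℝ EQ]
    [NormedAddCommGroup EF] [NormedSpace ℝ EF]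
    [TopologicalSpace G] [ChartedSpace EG G] [Group G]
    [TopologicalSpace P] [ChartedSpace EP P] [MulAction Gᵐᵒᵖ P]
    [TopologicalSpace Q] [ChartedSpace EQ Q] [IsManifold 𝓘(ℝ, EQ) ∞ Q] [MulAction Gᵐᵒᵖ Q]
    [TopologicalSpace F] [ChartedSpace EF F] extends MagneticSystem EP EQ EF P Q F where
  actP : IsFreeProperAction EG G EP P
  actQ : IsFreeProperAction EG G EQ Q
  ε_equivariant : ∀ (g : G) (p : P), ε (p <• g) = ε p <• g
  B_invariant : ∀ (g : G) (p : P) (v w : TangentSpace 𝓘(ℝ, EP) p),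
    B (p <• g) ![tangentAct g p v, tangentAct g p w] = B p ![v, w]
  L_invariant : ∀ (g : G) (x : FibredTangent EQ (ε : P → Q)), L (tangentLift g x) = L x

end Systems

/-- The orbit relation on a subset `S` of `X` of a right action of a subgroup `H` of `G` on `X`. -/
def orbitSetoidOn {G X : Type*} [Group G] (act : G → X → X) (h_one : ∀ x, act 1 x = x)
    (h_mul : ∀ g h x, act (g * h) x = act h (act g x)) (H : Subgroup G) (S : Set X) :
    Setoid S where
  r x y := ∃ g ∈ H, act g x = (y : X)
  iseqv :=
    { refl := fun x => ⟨1, H.one_mem, h_one x⟩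
      symm := by
        rintro x y ⟨g, hg, h⟩
        exact ⟨g⁻¹, H.inv_mem hg, by rw [← h, ← h_mul, mul_inv_cancel, h_one]⟩
      trans := by
        rintro x y z ⟨g, hg, h⟩ ⟨g', hg', h'⟩
        exact ⟨g * g', H.mul_mem hg hg', by rw [h_mul, h, h']⟩ }

namespace InvariantSystem

variable {EG G EP EQ EF P Q F : Type*}
  [NormedAddCommGroup EG] [NormedSpace ℝ EG]
  [NormedAddCommGroup EP] [NormedSpace ℝ EP] [NormedAddCommGroup EQ] [NormedSpace ℝ EQ]
  [NormedAddCommGroup EF] [NormedSpace ℝ EF]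
  [TopologicalSpace G] [ChartedSpace EG G] [Group G]
  [TopologicalSpace P] [ChartedSpace EP P] [MulAction Gᵐᵒᵖ P]
  [TopologicalSpace Q] [ChartedSpace EQ Q] [IsManifold 𝓘(ℝ, EQ) ∞ Q] [MulAction Gᵐᵒᵖ Q]
  [TopologicalSpace F] [ChartedSpace EF F]
  (S : InvariantSystem EG G EP EQ EF P Q F)

/-- `T_P Q`. -/
abbrev Tan : Type _ := FibredTangent EQ (S.ε : P → Q)

/-- `T*_P Q`. -/
abbrev Cot : Type _ := FibredCotangent EQ (S.ε : P → Q)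

/-- `δ : P → 𝔤*` is a `B𝔤`-potential: `i_{ξ_P} B = d δ_ξ` for all `ξ`. -/
structure IsBgPotential (δ : P → LieAlgDual EG G) : Prop where
  smooth : ContMDiff 𝓘(ℝ, EP) 𝓘(ℝ, LieAlgDual EG G) ∞ δ
  potential : ∀ (ξ : LieAlg EG G) (p : P) (v : TangentSpace 𝓘(ℝ, EP) p),
    S.B p ![infAction EG G p ξ, v] = mfderiv 𝓘(ℝ, EP) 𝓘(ℝ, ℝ) (fun p' => δ p' ξ) p v

/-- The 1-cocycle `σ_δ (g) = δ (p g⁻¹) - Ad*_{g⁻¹} δ (p)`, computed at the point `p`. For a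
`B𝔤`-potential `δ` on a connected `P` it does not depend on `p`. -/
def cocycle (δ : P → LieAlgDual EG G) (p : P) (g : G) : LieAlgDual EG G :=
  δ (p <• g⁻¹) - coAd g⁻¹ (δ p)

theorem isotropy_iff (δ : P → LieAlgDual EG G) (μ : LieAlgDual EG G) (g : G) (p : P) :
    μ = coAd g μ - cocycle δ p g⁻¹ ↔ μ + δ (p <• g) = coAd g (μ + δ p) := by
  unfold cocycle coAd
  rw [inv_inv, ContinuousLinearMap.add_comp]
  constructor
  · intro h
    nth_rewrite 1 [h]
    abel
  · intro h
    rw [eq_sub_iff_add_eq, add_sub, h]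
    abel

/-- The isotropy group `G_μ` of `μ` for the affine action on `𝔤*` with 1-cocycle `-σ_δ`:
`g ∈ G_μ` iff `μ = Ad*_g μ - σ_δ (g⁻¹)`, where `σ_δ` is computed at arbitrary points. -/
def isotropy [LieGroup 𝓘(ℝ, EG) ∞ G] (δ : P → LieAlgDual EG G) (μ : LieAlgDual EG G) :
    Subgroup G where
  carrier := {g | ∀ p : P, μ = coAd g μ - cocycle δ p g⁻¹}
  one_mem' := by
    intro p
    rw [isotropy_iff]
    ext ξ
    simp [coAd, Ad_one]
  mul_mem' := by
    intro g h hg hh p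
    have h1 := (isotropy_iff δ μ g p).1 (hg p)
    have h2 := (isotropy_iff δ μ h (p <• g)).1 (hh _)
    rw [isotropy_iff]
    have h3 : p <• (g * h) = (p <• g) <• h := by simp [mul_smul]
    rw [h3, h2, h1]
    ext ξ
    simp [coAd, Ad_mul]
  inv_mem' := by
    intro g hg p
    have h1 := (isotropy_iff δ μ g (p <• g⁻¹)).1 (hg _)
    have h3 : (p <• g⁻¹) <• g = p := by simp
    rw [isotropy_iff, ← h3, h1, h3]
    ext ξ
    have h4 : Ad EG g (Ad EG g⁻¹ ξ) = ξ := by rw [← Ad_mul, mul_inv_cancel, Ad_one]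
    simp [coAd, h4]

/-- The momentum map `J_δ` on `T*_P Q`: `⟨J_δ (α, p), ξ⟩ = ⟨α, ξ_Q (q)⟩ - δ_ξ (p)`, `q = ε (p)`. -/
def J (δ : P → LieAlgDual EG G) (α : S.Cot) : LieAlgDual EG G :=
  α.cov.comp (infAction EG G (S.ε α.proj)) - δ α.proj

/-- The momentum map `J_{L,δ} = J_δ ∘ 𝔽L` on `T_P Q`. -/
def JL (δ : P → LieAlgDual EG G) (x : S.Tan) : LieAlgDual EG G := S.J δ (fibreDerivative S.L x)

/-- `L` is `G`-regular: for every `(v, p)` the map `𝔤 → 𝔤*`, `ξ ↦ J_{L,δ} (v + ξ_Q (q), p)` is a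
diffeomorphism. -/
def IsGRegular (δ : P → LieAlgDual EG G) : Prop :=
  ∀ x : S.Tan, ∃ Φ : LieAlg EG G ≃ₘ⟮𝓘(ℝ, LieAlg EG G), 𝓘(ℝ, LieAlgDual EG G)⟯ LieAlgDual EG G,
    ∀ ξ : LieAlg EG G,
      Φ ξ = S.JL δ (FibredTangent.mk S.ε x.proj (x.vec + infAction EG G (S.ε x.proj) ξ))

/-- The level set `J_{L,δ}⁻¹ (μ)`. -/
def levelTan (δ : P → LieAlgDual EG G) (μ : LieAlgDual EG G) : Set S.Tan := {x | S.JL δ x = μ}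

/-- The level set `J_δ⁻¹ (μ)`. -/
def levelCot (δ : P → LieAlgDual EG G) (μ : LieAlgDual EG G) : Set S.Cot := {α | S.J δ α = μ}

/-- The bundle `V⁰_P π = V⁰π ×_Q P` of covectors that annihilate the vertical vectors `ξ_Q (q)`. -/
def annihilator : Set S.Cot :=
  {α | ∀ ξ : LieAlg EG G, α.cov (infAction EG G (S.ε α.proj) ξ) = 0}

/-! #### The lifted actions are right actions, and `𝔽L` is equivariant -/

theorem tan_ext {x y : S.Tan} (h : x.proj = y.proj) (h' : (x.vec : EQ) = (y.vec : EQ)) : x = y := by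
  obtain ⟨p, v⟩ := x
  obtain ⟨p', v'⟩ := y
  obtain rfl : p = p' := h
  obtain rfl : v = v' := h'
  rfl

theorem cot_ext {x y : S.Cot} (h : x.proj = y.proj)
    (h' : (x.cov : EQ →L[ℝ] ℝ) = (y.cov : EQ →L[ℝ] ℝ)) : x = y := by
  obtain ⟨p, v⟩ := x
  obtain ⟨p', v'⟩ := y
  obtain rfl : p = p' := h
  obtain rfl : v = v' := h'
  rfl

theorem tangentLift_one (x : S.Tan) : tangentLift (1 : G) x = x :=
  S.tan_ext (by simp [tangentLift, FibredTangent.mk]) (tangentAct_one (G := G) _ _)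

theorem tangentLift_mul (g h : G) (x : S.Tan) :
    tangentLift (g * h) x = tangentLift h (tangentLift g x) := by
  refine S.tan_ext (by simp [tangentLift, FibredTangent.mk, mul_smul]) ?_
  have key : ∀ q : Q, q = S.ε x.proj <• g → ∀ v : EQ,
      (tangentAct (E := EQ) h q v : EQ) = tangentAct (E := EQ) h (S.ε x.proj <• g) v := by
    rintro _ rfl v; rfl
  exact (tangentAct_mul S.actQ g h _ _).trans (key _ (S.ε_equivariant g x.proj) _).symm

theorem cotangentLift_one (x : S.Cot) : cotangentLift (1 : G) x = x := by
  refine S.cot_ext (by simp [cotangentLift]) (ContinuousLinearMap.ext fun v => ?_)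
  have key : ∀ g : G, g = 1 → ∀ q : Q, (tangentAct (E := EQ) g q v : EQ) = v := by
    rintro _ rfl q; exact tangentAct_one (G := G) _ _
  exact congrArg (x.cov : EQ →L[ℝ] ℝ) (key _ inv_one _)

theorem cotangentLift_mul (g h : G) (x : S.Cot) :
    cotangentLift (g * h) x = cotangentLift h (cotangentLift g x) := by
  refine S.cot_ext (by simp [cotangentLift, mul_smul]) (ContinuousLinearMap.ext fun v => ?_)
  have key : ∀ (k : G) (q q' : Q), k = h⁻¹ * g⁻¹ → q = S.ε (x.proj <• g <• h) →
      q' = S.ε (x.proj <• g) → (tangentAct (E := EQ) k q v : EQ) =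
        tangentAct (E := EQ) g⁻¹ q' (tangentAct (E := EQ) h⁻¹ (S.ε (x.proj <• g <• h)) v) := by
    rintro k q q' rfl rfl rfl
    refine (tangentAct_mul S.actQ h⁻¹ g⁻¹ _ v).trans ?_
    have : S.ε (x.proj <• g <• h) <• h⁻¹ = S.ε (x.proj <• g) := by
      rw [S.ε_equivariant h]; simp
    have key2 : ∀ q : Q, q = S.ε (x.proj <• g) → ∀ w : EQ,
        (tangentAct (E := EQ) g⁻¹ q w : EQ) =
          tangentAct (E := EQ) g⁻¹ (S.ε (x.proj <• g)) w := by
      rintro _ rfl w; rfl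
    exact key2 _ this _
  exact congrArg (x.cov : EQ →L[ℝ] ℝ)
    (key _ _ _ (mul_inv_rev g h) (by simp [mul_smul]) rfl)

/-- `T_q Ψ_g` as a linear isomorphism of the model space. -/
def tangentActEquiv (g : G) (p : P) : EQ ≃L[ℝ] EQ :=
  ContinuousLinearEquiv.equivOfInverse
    (tangentAct (E := EQ) g (S.ε p) : EQ →L[ℝ] EQ)
    (tangentAct (E := EQ) g⁻¹ (S.ε (p <• g)) : EQ →L[ℝ] EQ)
    (fun v => by
      have h := tangentAct_mul S.actQ g g⁻¹ (S.ε p) v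
      have key : ∀ (k : G) (q q' : Q), k = 1 → q' = q →
          (tangentAct (E := EQ) k (S.ε p) v : EQ) =
            tangentAct (E := EQ) g⁻¹ q (tangentAct (E := EQ) g (S.ε p) v) →
          (tangentAct (E := EQ) g⁻¹ q' (tangentAct (E := EQ) g (S.ε p) v) : EQ) = v := by
        rintro k q q' rfl rfl h
        exact h.symm.trans (tangentAct_one (G := G) _ _)
      exact key _ _ _ (mul_inv_cancel g) (S.ε_equivariant g p) h)
    (fun v => by
      have h := tangentAct_mul S.actQ g⁻¹ g (S.ε (p <• g)) v
      have key : ∀ (k : G) (q q' : Q), k = 1 → q' = q →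
          (tangentAct (E := EQ) k (S.ε (p <• g)) v : EQ) =
            tangentAct (E := EQ) g q (tangentAct (E := EQ) g⁻¹ (S.ε (p <• g)) v) →
          (tangentAct (E := EQ) g q' (tangentAct (E := EQ) g⁻¹ (S.ε (p <• g)) v) : EQ) = v := by
        rintro k q q' rfl rfl h
        exact h.symm.trans (tangentAct_one (G := G) _ _)
      exact key _ _ _ (inv_mul_cancel g) (by rw [S.ε_equivariant g]; simp) h)

/-- The Legendre transform is equivariant. -/
theorem legendre_equivariant (g : G) (x : S.Tan) :
    fibreDerivative S.L (tangentLift g x) = cotangentLift g (fibreDerivative S.L x) := by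
  refine S.cot_ext rfl ?_
  let T := S.tangentActEquiv g x.proj
  let f : EQ → ℝ := fun v => S.L (FibredTangent.mk S.ε (x.proj <• g) v)
  let f₀ : EQ → ℝ := fun v => S.L (FibredTangent.mk S.ε x.proj v)
  have h1 : f ∘ T = f₀ := by
    funext v
    exact S.L_invariant g (FibredTangent.mk S.ε x.proj v)
  have h2 : fderiv ℝ f₀ x.vec = (fderiv ℝ f (T x.vec)).comp (T : EQ →L[ℝ] EQ) := by
    rw [← h1]; exact T.comp_right_fderiv
  have h3 : fderiv ℝ f (T x.vec) = (fderiv ℝ f₀ x.vec).comp (T.symm : EQ →L[ℝ] EQ) := by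
    rw [h2]; ext v; simp
  exact h3

/-! #### The reduced spaces -/

section Reduction

variable [LieGroup 𝓘(ℝ, EG) ∞ G] (δ : P → LieAlgDual EG G) (μ : LieAlgDual EG G)

/-- The orbit relation of `G_μ` on a subset of `T_P Q`. -/
def setoidTan (Z : Set S.Tan) : Setoid Z :=
  orbitSetoidOn (G := G) tangentLift S.tangentLift_one S.tangentLift_mul (isotropy δ μ) Z

/-- The orbit relation of `G_μ` on a subset of `T*_P Q`. -/
def setoidCot (Z : Set S.Cot) : Setoid Z :=
  orbitSetoidOn (G := G) cotangentLift S.cotangentLift_one S.cotangentLift_mul (isotropy δ μ) Z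

/-- `J_{L,δ}⁻¹ (μ) / G_μ`. -/
abbrev RedTan : Type _ := Quotient (S.setoidTan δ μ (S.levelTan δ μ))

/-- `J_δ⁻¹ (μ) / G_μ`. -/
abbrev RedCot : Type _ := Quotient (S.setoidCot δ μ (S.levelCot δ μ))

/-- `V⁰_P π / G_μ`. -/
abbrev RedAnn : Type _ := Quotient (S.setoidCot δ μ S.annihilator)

/-- The projection `π_μ : J_{L,δ}⁻¹ (μ) → J_{L,δ}⁻¹ (μ) / G_μ`. -/
def projTan (x : S.levelTan δ μ) : S.RedTan δ μ := Quotient.mk _ x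

/-- `P / G_μ`. -/
abbrev PMod : Type _ :=
  MulAction.orbitRel.Quotient (isotropy (P := P) δ μ).op P

/-- The projection `P → P / G_μ`. -/
def projP (p : P) : PMod δ μ := Quotient.mk (MulAction.orbitRel (isotropy (P := P) δ μ).op P) p

theorem projP_act {g : G} (hg : g ∈ isotropy δ μ) (p : P) : projP δ μ (p <• g) = projP δ μ p :=
  Quotient.sound ⟨⟨MulOpposite.op g, hg⟩, rfl⟩

/-- The map `P / G_μ → Q / G`, `[p] ↦ [ε (p)]`, induced by `ε`. -/
def εRed : PMod δ μ → OrbitSpace G Q :=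
  Quotient.lift (fun p => orbitProj G (S.ε p)) (by
    rintro _ p ⟨⟨k, hk⟩, rfl⟩
    have h := S.ε_equivariant k.unop p
    exact (congrArg (orbitProj G) h).trans (orbitProj_act k.unop (S.ε p)))

variable {EB : Type*} [NormedAddCommGroup EB] [NormedSpace ℝ EB]
  [ChartedSpace EB (OrbitSpace G Q)]

/-- `T_{P/G_μ} (Q/G) = T(Q/G) ×_{Q/G} P/G_μ`. -/
abbrev BaseTan (EB : Type*) [NormedAddCommGroup EB] [NormedSpace ℝ EB]
    [ChartedSpace EB (OrbitSpace G Q)] : Type _ := FibredTangent EB (S.εRed δ μ)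

/-- `T*_{P/G_μ} (Q/G) = T*(Q/G) ×_{Q/G} P/G_μ`. -/
abbrev BaseCot (EB : Type*) [NormedAddCommGroup EB] [NormedSpace ℝ EB]
    [ChartedSpace EB (OrbitSpace G Q)] : Type _ := FibredCotangent EB (S.εRed δ μ)

/-- The tangent map `T_q π : T_q Q → T_{[q]} (Q/G)` at `q = ε (p)`. -/
def tangentProj (EB : Type*) [NormedAddCommGroup EB] [NormedSpace ℝ EB]
    [ChartedSpace EB (OrbitSpace G Q)] (p : P) : TangentSpace 𝓘(ℝ, EQ) (S.ε p) →L[ℝ]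
      TangentSpace 𝓘(ℝ, EB) (S.εRed δ μ (projP δ μ p)) :=
  mfderiv 𝓘(ℝ, EQ) 𝓘(ℝ, EB) (orbitProj G : Q → OrbitSpace G Q) (S.ε p)

theorem tangentProj_act (hπ : IsQuotientStructure G EQ Q EB) (g : G) (p : P) (v : EQ) :
    (S.tangentProj δ μ EB (p <• g) (tangentAct (E := EQ) g (S.ε p) v : EQ) : EB) =
      S.tangentProj δ μ EB p v := by
  have key : ∀ q : Q, q = S.ε p <• g → ∀ w : EQ,
      (mfderiv 𝓘(ℝ, EQ) 𝓘(ℝ, EB) (orbitProj G : Q → OrbitSpace G Q) q w : EB) =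
      mfderiv 𝓘(ℝ, EQ) 𝓘(ℝ, EB) (orbitProj G : Q → OrbitSpace G Q) (S.ε p <• g) w := by
    rintro _ rfl w; rfl
  exact (key _ (S.ε_equivariant g p) _).trans
    (mfderiv_orbitProj_tangentAct S.actQ hπ g (S.ε p) v)

theorem baseTan_ext {x y : S.BaseTan δ μ EB} (h : x.proj = y.proj)
    (h' : (x.vec : EB) = (y.vec : EB)) : x = y := by
  obtain ⟨p, v⟩ := x
  obtain ⟨p', v'⟩ := y
  obtain rfl : p = p' := h
  obtain rfl : v = v' := h'
  rfl

/-- The map `Π_μ : J_{L,δ}⁻¹ (μ) / G_μ → T_{P/G_μ} (Q/G)`, `[(v, p)] ↦ (T_q π (v), [p])`. -/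
def Pi (hπ : IsQuotientStructure G EQ Q EB) : S.RedTan δ μ → S.BaseTan δ μ EB :=
  Quotient.lift
    (fun x : S.levelTan δ μ => FibredTangent.mk (S.εRed δ μ) (projP δ μ x.1.proj)
      (S.tangentProj δ μ EB x.1.proj x.1.vec))
    (by
      rintro ⟨x, hx⟩ ⟨_, hy⟩ ⟨g, hg, rfl⟩
      refine (S.baseTan_ext δ μ (x := FibredTangent.mk (S.εRed δ μ) (projP δ μ (x.proj <• g))
        (S.tangentProj δ μ EB (x.proj <• g) (tangentAct (E := EQ) g (S.ε x.proj) x.vec : EQ)))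
        (y := FibredTangent.mk (S.εRed δ μ) (projP δ μ x.proj)
          (S.tangentProj δ μ EB x.proj x.vec)) (projP_act δ μ hg x.proj) ?_).symm
      exact S.tangentProj_act δ μ hπ g x.proj x.vec)

/-- The reduced Legendre transform `[(𝔽L)_μ] : J_{L,δ}⁻¹ (μ) / G_μ → J_δ⁻¹ (μ) / G_μ`, the quotient
of the restriction of `𝔽L`. -/
def redLegendre : S.RedTan δ μ → S.RedCot δ μ :=
  Quotient.lift (fun x : S.levelTan δ μ => Quotient.mk _ ⟨fibreDerivative S.L x.1, x.2⟩)
    (by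
      rintro ⟨x, hx⟩ ⟨_, hy⟩ ⟨g, hg, rfl⟩
      exact Quotient.sound ⟨g, hg, (S.legendre_equivariant g x).symm⟩)

variable (A : PrincipalConnection EG G EQ Q)

/-- The covector `⟨μ + δ (p), 𝒜 (q)⟩ : v ↦ ⟨μ + δ (p), 𝒜 (q) (v)⟩` on `T_q Q`, `q = ε (p)`. -/
def shiftCov (p : P) : TangentSpace 𝓘(ℝ, EQ) (S.ε p) →L[ℝ] ℝ :=
  (μ + δ p).comp (A.form (S.ε p))

theorem shiftCov_act {g : G} (hg : g ∈ isotropy δ μ) (p : P) (v : EQ) :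
    S.shiftCov δ μ A (p <• g) (tangentAct (E := EQ) g (S.ε p) v : EQ) =
      S.shiftCov δ μ A p v := by
  have h1 := (isotropy_iff δ μ g p).1 (hg p)
  have key : ∀ q : Q, q = S.ε p <• g → ∀ w : EQ,
      (A.form q w : EG) = A.form (S.ε p <• g) w := by
    rintro _ rfl w; rfl
  have h2 := (key _ (S.ε_equivariant g p) (tangentAct (E := EQ) g (S.ε p) v)).trans
    (A.equivariant g (S.ε p) v)
  have h4 : ∀ ξ, Ad EG g (Ad EG g⁻¹ ξ) = ξ := fun ξ => by rw [← Ad_mul, mul_inv_cancel, Ad_one]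
  refine (congrArg (μ + δ (p <• g)) h2).trans ?_
  rw [h1]
  exact congrArg (μ + δ p) (h4 _)

/-- The shift map `φ_μ^𝒜 : J_δ⁻¹ (μ) → V⁰_P π`, `(α, p) ↦ (α - ⟨μ + δ (p), 𝒜 (q)⟩, p)`. -/
def shift (α : S.levelCot δ μ) : S.annihilator :=
  ⟨⟨α.1.proj, α.1.cov - S.shiftCov δ μ A α.1.proj⟩, by
    intro ξ
    have h : S.J δ α.1 ξ = μ ξ := congrArg (fun ν : LieAlgDual EG G => ν ξ) α.2
    have h1 : S.J δ α.1 ξ =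
      α.1.cov (infAction EG G (S.ε α.1.proj) ξ) - δ α.1.proj ξ := rfl
    have h2 : S.shiftCov δ μ A α.1.proj (infAction EG G (S.ε α.1.proj) ξ) =
        μ ξ + δ α.1.proj ξ :=
      congrArg (μ + δ α.1.proj) (A.vertical (S.ε α.1.proj) ξ)
    have h3 : (α.1.cov - S.shiftCov δ μ A α.1.proj) (infAction EG G (S.ε α.1.proj) ξ) =
        α.1.cov (infAction EG G (S.ε α.1.proj) ξ) -
          S.shiftCov δ μ A α.1.proj (infAction EG G (S.ε α.1.proj) ξ) := rfl
    refine h3.trans ?_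
    rw [h2, ← h, h1]
    ring⟩

theorem shift_act {g : G} (hg : g ∈ isotropy δ μ) (α : S.levelCot δ μ)
    (h : cotangentLift g α.1 ∈ S.levelCot δ μ) :
    cotangentLift g (S.shift δ μ A α).1 = (S.shift δ μ A ⟨cotangentLift g α.1, h⟩).1 := by
  refine S.cot_ext rfl (ContinuousLinearMap.ext fun w => ?_)
  obtain ⟨v, rfl⟩ := (S.tangentActEquiv g α.1.proj).surjective w
  have h1 := S.shiftCov_act δ μ A hg α.1.proj v
  have h2 : (tangentAct (E := EQ) g⁻¹ (S.ε (α.1.proj <• g))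
      (S.tangentActEquiv g α.1.proj v) : EQ) = v :=
    (S.tangentActEquiv g α.1.proj).symm_apply_apply v
  have h3 : (S.shiftCov δ μ A α.1.proj (tangentAct (E := EQ) g⁻¹ (S.ε (α.1.proj <• g))
      (S.tangentActEquiv g α.1.proj v) : EQ)) = S.shiftCov δ μ A α.1.proj v :=
    congrArg (S.shiftCov δ μ A α.1.proj : EQ →L[ℝ] ℝ) h2
  exact congrArg (fun r => α.1.cov (tangentAct (E := EQ) g⁻¹ (S.ε (α.1.proj <• g))
      (S.tangentActEquiv g α.1.proj v) : EQ) - r) (h3.trans h1.symm)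

/-- The reduced shift map `[φ_μ^𝒜] : J_δ⁻¹ (μ) / G_μ → V⁰_P π / G_μ`. -/
def redShift : S.RedCot δ μ → S.RedAnn δ μ :=
  Quotient.lift (fun α => Quotient.mk _ (S.shift δ μ A α)) (by
    rintro ⟨α, hα⟩ ⟨_, hβ⟩ ⟨g, hg, rfl⟩
    exact Quotient.sound ⟨g, hg, S.shift_act δ μ A hg ⟨α, hα⟩ hβ⟩)

/-- The pullback of a covector on `Q/G`: for `β ∈ T*_{[q]} (Q/G)`, the point `(β ∘ T_q π, p)` of
`V⁰_P π`, where `q = ε (p)`. -/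
def pullbackCov (hπ : IsQuotientStructure G EQ Q EB) (p : P)
    (β : TangentSpace 𝓘(ℝ, EB) (S.εRed δ μ (projP δ μ p)) →L[ℝ] ℝ) : S.annihilator :=
  ⟨⟨p, β.comp (S.tangentProj δ μ EB p)⟩, fun ξ =>
    (congrArg β (mfderiv_orbitProj_infAction S.actQ hπ (S.ε p) ξ)).trans (map_zero β)⟩

/-- The canonical identification of `T*_{P/G_μ} (Q/G)` with `V⁰_P π / G_μ`:
`(β, [p]) ↦ [(β ∘ T_q π, p)]`, `q = ε (p)`. -/
def cotId (hπ : IsQuotientStructure G EQ Q EB) (β : S.BaseCot δ μ EB) : S.RedAnn δ μ :=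
  Quotient.mk _ (S.pullbackCov δ μ hπ (Quotient.out β.proj) (β.cov : EB →L[ℝ] ℝ))

/-- The identification does not depend on the representative `p`. -/
theorem cotId_mk (hπ : IsQuotientStructure G EQ Q EB) (p : P)
    (β : TangentSpace 𝓘(ℝ, EB) (S.εRed δ μ (projP δ μ p)) →L[ℝ] ℝ) :
    S.cotId δ μ hπ ⟨projP δ μ p, β⟩ = Quotient.mk _ (S.pullbackCov δ μ hπ p β) := by
  obtain ⟨⟨k, hk⟩, hkp⟩ : (MulAction.orbitRel (isotropy (P := P) δ μ).op P).r
      (Quotient.out (projP δ μ p)) p := Quotient.exact (Quotient.out_eq (projP δ μ p))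
  unfold cotId
  symm
  apply Quotient.sound
  refine ⟨k.unop, hk, ?_⟩
  have hkp' : p <• k.unop = Quotient.out (projP δ μ p) := hkp
  refine S.cot_ext hkp' (ContinuousLinearMap.ext fun w => ?_)
  obtain ⟨v, rfl⟩ := (S.tangentActEquiv k.unop p).surjective w
  have h1 := S.tangentProj_act δ μ hπ k.unop p v
  have h2 : (tangentAct (E := EQ) k.unop⁻¹ (S.ε (p <• k.unop))
      (S.tangentActEquiv k.unop p v) : EQ) = v :=
    (S.tangentActEquiv k.unop p).symm_apply_apply v
  have key : ∀ p' : P, p' = p <• k.unop → ∀ w : EQ,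
      (S.tangentProj δ μ EB p' w : EB) = S.tangentProj δ μ EB (p <• k.unop) w := by
    rintro _ rfl w; rfl
  have h3 := (key _ hkp'.symm (S.tangentActEquiv k.unop p v)).trans h1
  have h4 : (S.tangentProj δ μ EB p (tangentAct (E := EQ) k.unop⁻¹ (S.ε (p <• k.unop))
      (S.tangentActEquiv k.unop p v) : EQ) : EB) = S.tangentProj δ μ EB p v :=
    congrArg (S.tangentProj δ μ EB p : EQ →L[ℝ] EB) h2
  exact congrArg (β : EB →L[ℝ] ℝ) (h4.trans h3.symm)

/-- The quotient to `J_{L,δ}⁻¹ (μ) / G_μ` of the restriction to `J_{L,δ}⁻¹ (μ)` of the function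
`(v, p) ↦ L (v, p) - ⟨μ + δ (p), 𝒜 (q) (v)⟩`. -/
def redLagrangian : S.RedTan δ μ → ℝ :=
  Quotient.lift
    (fun x : S.levelTan δ μ => S.L x.1 - (μ + δ x.1.proj) (A.form (S.ε x.1.proj) x.1.vec))
    (by
      rintro ⟨x, hx⟩ ⟨_, hy⟩ ⟨g, hg, rfl⟩
      have h1 := S.L_invariant g x
      have h2 := S.shiftCov_act δ μ A hg x.proj x.vec
      exact (congrArg₂ (fun a b : ℝ => a - b) h1 h2).symm)

/-- The Routhian `L̃`, the pullback under `Δ : T_{P/G_μ} (Q/G) → J_{L,δ}⁻¹ (μ) / G_μ` of the quotient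
of `L - ⟨μ + δ, 𝒜⟩`. -/
def routhian (Δ : S.BaseTan δ μ EB → S.RedTan δ μ) : S.BaseTan δ μ EB → ℝ :=
  fun z => S.redLagrangian δ μ A (Δ z)

end Reduction

end InvariantSystem

end Routh

end

/-! Fix `p` and put q = ε(p). By regularity, J_{L,δ} restricts to a diffeomorphism onto 𝔤* on each
coset v + {ξ_Q(q)}, so each coset contains exactly one vector of momentum μ. These cosets are the
fibres of T_qπ, so the part of the level set over `p` is the image of a section s of T_qπ
(`levelTan_unique`, `exists_levelTan`). This makes `Pi` bijective.

Over [p] the Routhian is R ∘ s with R = L - ⟨μ + δ(p), 𝒜(q)⟩. At a vector of momentum μ the covector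
dR = 𝔽L - ⟨μ + δ(p), 𝒜(q)⟩ kills every ξ_Q(q), hence equals β ∘ T_qπ for some β on Q/G. Since T_qπ ∘
Ds = id, the derivative of R ∘ s is β, whatever Ds is (`hasFDerivAt_comp_section`,
`hasFDerivAt_routhian`). This β is also what the shift map followed by the identification of
covectors yields. In the energy the two occurrences of ⟨μ + δ(p), 𝒜(q)(v)⟩ cancel.

Two points need analysis. The section s is found pointwise, and its differentiability comes from the
implicit function theorem together with global uniqueness on cosets
(`differentiable_of_fibrewise_diffeomorph`). And ker T_qπ must contain nothing but the ξ_Q(q)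
(`exists_infAction_eq`): the fibre of π through q is an orbit, hence a smooth image of G, and
comparing Hausdorff dimensions gives dim ker T_qπ ≤ dim G (`finrank_ker_mfderiv_le`). -/

noncomputable section

namespace Routh

/-! ### Dimension of the fibres of a submersion -/

/-- Near a point where its derivative is onto, the level set of a `C^1` map projects onto a
neighbourhood in the kernel of the derivative. -/
theorem exists_proj_levelSet_mem_nhds {E F : Type*} [NormedAddCommGroup E] [NormedSpace ℝ E]
    [FiniteDimensional ℝ E] [NormedAddCommGroup F] [NormedSpace ℝ F] [FiniteDimensional ℝ F]
    {f : E → F} {f' : E →L[ℝ] F} {a : E} (hf : HasStrictFDerivAt f f' a)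
    (hf' : Function.Surjective f') {U : Set E} (hU : U ∈ nhds a) :
    ∃ pr : E →L[ℝ] f'.ker, (fun x => pr (x - a)) '' {x ∈ U | f x = f a} ∈ nhds 0 := by
  have := FiniteDimensional.complete ℝ E
  have := FiniteDimensional.complete ℝ F
  have hr : f'.range = ⊤ := LinearMap.range_eq_top.2 hf'
  have hk : f'.ker.ClosedComplemented := Submodule.ClosedComplemented.of_finiteDimensional _
  refine ⟨Classical.choose hk, ?_⟩
  -- Near `a` the pair (f, pr(· - a)) is a local homeomorphism. It maps `U` onto a neighbourhood of
  -- (f a, 0), and the slice with first coordinate f a is the image of the level set.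
  let e := hf.implicitToOpenPartialHomeomorphOfComplemented f f' hr hk
  have he : ∀ y, e y = (f y, (Classical.choose hk) (y - a)) :=
    hf.implicitToOpenPartialHomeomorphOfComplemented_apply hr hk
  have ha : a ∈ e.source := hf.mem_implicitToOpenPartialHomeomorphOfComplemented_source hr hk
  have hea : e a = (f a, 0) := by rw [he]; simp
  have h1 : e '' (U ∩ e.source) ∈ nhds (f a, (0 : f'.ker)) := by
    rw [← hea]
    have h := e.map_nhds_eq ha
    rw [← h]
    exact Filter.image_mem_map (Filter.inter_mem hU (e.open_source.mem_nhds ha))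
  have h2 : Filter.Tendsto (fun k : f'.ker => (f a, k)) (nhds 0) (nhds (f a, 0)) :=
    Continuous.tendsto' (by fun_prop) _ _ rfl
  filter_upwards [h2 h1] with k hk'
  obtain ⟨x, ⟨hxU, -⟩, hx⟩ := hk'
  rw [he] at hx
  exact ⟨x, ⟨hxU, congrArg Prod.fst hx⟩, congrArg Prod.snd hx⟩

/-- The Hausdorff dimension of the image of a `C^1` map is at most the dimension of its domain. -/
theorem dimH_image_le_of_contMDiffAt {E M F : Type*} [NormedAddCommGroup E] [NormedSpace ℝ E]
    [FiniteDimensional ℝ E] [TopologicalSpace M] [ChartedSpace E M] [SecondCountableTopology M]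
    [NormedAddCommGroup F] [NormedSpace ℝ F] {f : M → F} {s : Set M}
    (hf : ∀ x ∈ s, ContMDiffAt 𝓘(ℝ, E) 𝓘(ℝ, F) 1 f x) :
    dimH (f '' s) ≤ Module.finrank ℝ E := by
  have hloc : ∀ x ∈ s, ∃ t ∈ nhds x, dimH (f '' t) ≤ Module.finrank ℝ E := by
    intro x hx
    let φ := extChartAt 𝓘(ℝ, E) x
    have h1 : ContDiffAt ℝ 1 (f ∘ φ.symm) (φ x) := by
      have h := (contMDiffAt_iff.1 (hf x hx)).2
      simpa [contDiffWithinAt_univ, chartAt_self_eq, φ, extChartAt] using h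
    obtain ⟨K, t, ht, hK⟩ := h1.exists_lipschitzOnWith
    refine ⟨φ.source ∩ φ ⁻¹' t, Filter.inter_mem (extChartAt_source_mem_nhds x)
      ((continuousAt_extChartAt x).preimage_mem_nhds ht), ?_⟩
    have h2 : f '' (φ.source ∩ φ ⁻¹' t) ⊆ (f ∘ φ.symm) '' t := by
      rintro _ ⟨y, ⟨hy, hyt⟩, rfl⟩
      exact ⟨φ y, hyt, congrArg f (φ.left_inv hy)⟩
    -- In a chart a C^1 map is locally Lipschitz, and Lipschitz maps do not raise Hausdorff
    -- dimension.
    calc dimH (f '' (φ.source ∩ φ ⁻¹' t)) ≤ dimH ((f ∘ φ.symm) '' t) := dimH_mono h2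
      _ ≤ dimH t := hK.dimH_image_le
      _ ≤ dimH (Set.univ : Set E) := dimH_mono (Set.subset_univ _)
      _ = Module.finrank ℝ E := Real.dimH_univ_eq_finrank E
  choose! t ht htd using hloc
  -- Second countability reduces to countably many pieces; the dimension of a countable union is the
  -- supremum.
  obtain ⟨c, hcs, hc, hsc⟩ := TopologicalSpace.countable_cover_nhdsWithin
    (fun x hx => mem_nhdsWithin_of_mem_nhds (ht x hx))
  calc dimH (f '' s) ≤ dimH (⋃ x ∈ c, f '' t x) := by
        refine dimH_mono ?_
        rw [← Set.image_iUnion₂]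
        exact Set.image_mono hsc
    _ = ⨆ x ∈ c, dimH (f '' t x) := dimH_bUnion hc _
    _ ≤ Module.finrank ℝ E := iSup₂_le fun x hx => htd x (hcs hx)

/-- If a level set of a submersion is the image of a smooth map from `N`, the kernel of the
derivative has dimension at most `dim N`. -/
theorem finrank_ker_mfderiv_le {EN N E M EB B : Type*}
    [NormedAddCommGroup EN] [NormedSpace ℝ EN] [FiniteDimensional ℝ EN]
    [TopologicalSpace N] [ChartedSpace EN N] [SecondCountableTopology N]
    [NormedAddCommGroup E] [NormedSpace ℝ E] [FiniteDimensional ℝ E]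
    [TopologicalSpace M] [ChartedSpace E M] [IsManifold 𝓘(ℝ, E) ∞ M]
    [NormedAddCommGroup EB] [NormedSpace ℝ EB] [FiniteDimensional ℝ EB]
    [TopologicalSpace B] [ChartedSpace EB B]
    {p : M → B} (hp : ContMDiff 𝓘(ℝ, E) 𝓘(ℝ, EB) ∞ p) (q : M)
    {p' : E →L[ℝ] EB} (hp' : mfderiv 𝓘(ℝ, E) 𝓘(ℝ, EB) p q = p') (hq : Function.Surjective p')
    {o : N → M} (ho : ContMDiff 𝓘(ℝ, EN) 𝓘(ℝ, E) ∞ o)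
    (hfib : ∀ x, p x = p q → x ∈ Set.range o) :
    Module.finrank ℝ p'.ker ≤ Module.finrank ℝ EN := by
  let φ := extChartAt 𝓘(ℝ, E) q
  let χ := extChartAt 𝓘(ℝ, EB) (p q)
  let f : E → EB := χ ∘ p ∘ φ.symm
  have hfc : ContDiffAt ℝ ∞ f (φ q) := by
    have h := (contMDiffAt_iff.1 (hp q)).2
    simpa [contDiffWithinAt_univ, f, φ, χ] using h
  have hf' : p' = fderiv ℝ f (φ q) := by
    rw [← fderivWithin_univ, ← hp']
    exact (hp.mdifferentiable (by simp) q).mfderiv.trans (by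
      rw [modelWithCornersSelf_coe, Set.range_id]; rfl)
  have hs : HasStrictFDerivAt f p' (φ q) := by
    rw [hf']
    exact hfc.hasStrictFDerivAt (by simp)
  -- Only on this set does equality of the coordinate expression `f` imply equality of `p`, by
  -- injectivity of χ.
  have hU : φ.target ∩ φ.symm ⁻¹' (p ⁻¹' χ.source) ∈ nhds (φ q) := by
    refine Filter.inter_mem (extChartAt_target_mem_nhds q) ?_
    refine (continuousAt_extChartAt_symm q).preimage_mem_nhds ?_
    rw [extChartAt_to_inv]
    exact hp.continuous.continuousAt.preimage_mem_nhds (extChartAt_source_mem_nhds _)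
  obtain ⟨pr, hpr⟩ := exists_proj_levelSet_mem_nhds hs hq hU
  -- The parametrization `o`, read in the chart and projected to the kernel. Since `o` covers the
  -- level set, the image of `F` contains a neighbourhood of 0 in the kernel, so it has the full
  -- dimension of the kernel.
  let F : N → p'.ker := fun n => pr (φ (o n) - φ q)
  let s : Set N := o ⁻¹' φ.source
  have hF : ∀ n ∈ s, ContMDiffAt 𝓘(ℝ, EN) 𝓘(ℝ, p'.ker) 1 F n := by
    intro n hn
    have h1 : ContMDiffAt 𝓘(ℝ, E) 𝓘(ℝ, E) ∞ φ (o n) :=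
      contMDiffAt_extChartAt' (by rw [← extChartAt_source 𝓘(ℝ, E)]; exact hn)
    have h2 : ContMDiffAt 𝓘(ℝ, EN) 𝓘(ℝ, E) ∞ (fun n => φ (o n)) n := h1.comp n (ho n)
    have h3 : ContDiff ℝ ∞ (fun x : E => pr (x - φ q)) := by fun_prop
    exact (h3.contMDiff.contMDiffAt.comp n h2).of_le (by simp)
  have hsub : (fun x => pr (x - φ q)) '' {x ∈ φ.target ∩ φ.symm ⁻¹' (p ⁻¹' χ.source) |
      f x = f (φ q)} ⊆ F '' s := by
    rintro _ ⟨x, ⟨⟨hx1, hx2⟩, hx3⟩, rfl⟩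
    have h1 : p (φ.symm x) = p q := by
      refine χ.injOn hx2 (mem_extChartAt_source _) ?_
      have h4 : f (φ q) = χ (p q) := congrArg (χ ∘ p) (extChartAt_to_inv q)
      exact hx3.trans h4
    obtain ⟨n, hn⟩ := hfib _ h1
    refine ⟨n, ?_, ?_⟩
    · change o n ∈ φ.source
      rw [hn]
      exact φ.map_target hx1
    · change pr (φ (o n) - φ q) = _
      rw [hn, φ.right_inv hx1]
  have h5 := Real.dimH_of_mem_nhds (Filter.mem_of_superset hpr hsub)
  have h6 := dimH_image_le_of_contMDiffAt hF
  rw [h5] at h6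
  exact_mod_cast h6

/-! ### Differentiable solutions of fibrewise regular equations -/

/-- The solutions `v` of `T v = w`, `m v = c` depend differentiably on `w` if `m` is smooth
and restricts to diffeomorphisms of the affine subspaces `v + ker T`. -/
theorem differentiable_of_fibrewise_diffeomorph {EG EQ EB V : Type*}
    [NormedAddCommGroup EG] [NormedSpace ℝ EG] [FiniteDimensional ℝ EG]
    [NormedAddCommGroup EQ] [NormedSpace ℝ EQ]
    [NormedAddCommGroup EB] [NormedSpace ℝ EB] [FiniteDimensional ℝ EB]
    [NormedAddCommGroup V] [NormedSpace ℝ V] [CompleteSpace V]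
    (T : EQ →L[ℝ] EB) (hT : Function.Surjective T) (ψ : EG →L[ℝ] EQ)
    (hψ : ∀ v, T v = 0 → ∃ ξ, ψ ξ = v)
    (m : EQ → V) (hm : ContDiff ℝ 1 m)
    (hreg : ∀ v, ∃ Φ : EG ≃ₘ⟮𝓘(ℝ, EG), 𝓘(ℝ, V)⟯ V, ∀ ξ, Φ ξ = m (v + ψ ξ))
    (c : V) (s : EB → EQ) (hs : ∀ w, T (s w) = w) (hc : ∀ w, m (s w) = c) :
    Differentiable ℝ s := by
  have := FiniteDimensional.complete ℝ EG
  have := FiniteDimensional.complete ℝ EB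
  -- A linear section `H` of `T` gives s w = H w + ψ (ξ w), so only the vertical coordinate `ξ` is
  -- in question.
  obtain ⟨H, hH⟩ := T.exists_rightInverse_of_surjective (LinearMap.range_eq_top.2 hT)
  have hH' : ∀ w, T (H w) = w := fun w => congrArg (fun R : EB →L[ℝ] EB => R w) hH
  have hξ : ∀ w, ∃ ξ, s w = H w + ψ ξ := fun w => by
    obtain ⟨ξ, hξ⟩ := hψ (s w - H w) (by rw [map_sub, hs, hH', sub_self])
    exact ⟨ξ, by rw [hξ]; abel⟩
  choose ξ hξ using hξ
  suffices hd : Differentiable ℝ ξ by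
    have : s = fun w => H w + ψ (ξ w) := funext hξ
    rw [this]
    exact H.differentiable.add (ψ.differentiable.comp hd)
  intro w₀
  let f : EB × EG → V := fun z => m (H z.1 + ψ z.2)
  have hf : ContDiff ℝ 1 f := hm.comp (by fun_prop)
  let u : EB × EG := (w₀, ξ w₀)
  have hstr : HasStrictFDerivAt f (fderiv ℝ f u) u := hf.contDiffAt.hasStrictFDerivAt (by simp)
  obtain ⟨Φ, hΦ⟩ := hreg (H w₀)
  -- The partial map η ↦ f (w₀, η) is itself the diffeomorphism `Φ`, so its derivative is
  -- invertible.
  have hinv : (fderiv ℝ f u ∘SL ContinuousLinearMap.inr ℝ EB EG).IsInvertible := by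
    have h1 : HasFDerivAt (fun η => f (w₀, η))
        (fderiv ℝ f u ∘SL ContinuousLinearMap.inr ℝ EB EG) (ξ w₀) :=
      hstr.hasFDerivAt.comp (ξ w₀) (hasFDerivAt_prodMk_right w₀ (ξ w₀))
    have h2 : (fun η => f (w₀, η)) = Φ := funext fun η => (hΦ η).symm
    rw [h2] at h1
    refine ⟨Φ.mfderivToContinuousLinearEquiv (by simp) (ξ w₀), ?_⟩
    rw [← h1.fderiv, ← mfderiv_eq_fderiv]
    rfl
  have hloc := hstr.hasStrictFDerivAt_implicitFunctionOfProdDomain hinv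
  have hev := hstr.eventually_apply_implicitFunctionOfProdDomain hinv
  have hfu : f u = c := by rw [← hc w₀, hξ w₀]
  -- Uniqueness holds on the whole coset because `Φ'` is injective. So the implicit function agrees
  -- with `ξ` near `w₀` although `ξ` is not known to be continuous.
  have heq : hstr.implicitFunctionOfProdDomain hinv =ᶠ[nhds w₀] ξ := by
    filter_upwards [hev] with w hw
    obtain ⟨Φ', hΦ'⟩ := hreg (H w)
    apply Φ'.injective
    have h1 : Φ' (ξ w) = c := by rw [hΦ', ← hξ w, hc w]
    exact ((hΦ' _).trans (hw.trans hfu)).trans h1.symm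
  exact (heq.hasFDerivAt_iff.1 hloc.hasFDerivAt).differentiableAt

/-- The derivative of `R ∘ s`, for a section `s` of `T` and a function `R` whose derivative along
`s` is a pullback under `T`. -/
theorem hasFDerivAt_comp_section {EQ EB : Type*} [NormedAddCommGroup EQ] [NormedSpace ℝ EQ]
    [NormedAddCommGroup EB] [NormedSpace ℝ EB] {T : EQ →L[ℝ] EB} {s : EB → EQ}
    (hs : ∀ w, T (s w) = w) (hd : Differentiable ℝ s) {R : EQ → ℝ} {β : EB →L[ℝ] ℝ} {w : EB}
    (hR : HasFDerivAt R (β.comp T) (s w)) : HasFDerivAt (fun w => R (s w)) β w := by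
  have h1 := hR.comp w (hd w).hasFDerivAt
  have h2 : T.comp (fderiv ℝ s w) = ContinuousLinearMap.id ℝ EB := by
    have h3 := T.hasFDerivAt.comp w (hd w).hasFDerivAt
    have h4 : (T ∘ s) = id := funext hs
    rw [h4] at h3
    exact h3.unique (hasFDerivAt_id w)
  rw [ContinuousLinearMap.comp_assoc, h2, ContinuousLinearMap.comp_id] at h1
  exact h1

/-! ### Vertical vectors and the equivariance of the infinitesimal action -/

section Actions

variable {EG G E M : Type*} [NormedAddCommGroup EG] [NormedSpace ℝ EG]
  [NormedAddCommGroup E] [NormedSpace ℝ E]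
  [TopologicalSpace G] [ChartedSpace EG G] [Group G]
  [TopologicalSpace M] [ChartedSpace E M] [MulAction Gᵐᵒᵖ M]

/-- The vectors tangent to the fibres of `M → M / G` are the values of the fundamental vector
fields. -/
theorem exists_infAction_eq [FiniteDimensional ℝ EG] [FiniteDimensional ℝ E]
    [SecondCountableTopology G] [IsManifold 𝓘(ℝ, E) ∞ M]
    {EB : Type*} [NormedAddCommGroup EB] [NormedSpace ℝ EB] [FiniteDimensional ℝ EB]
    [ChartedSpace EB (OrbitSpace G M)] (hM : IsFreeProperAction EG G E M)
    (hπ : IsQuotientStructure G E M EB) (A : PrincipalConnection EG G E M) (m : M) (v : E)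
    (hv : (mfderiv 𝓘(ℝ, E) 𝓘(ℝ, EB) (orbitProj G : M → OrbitSpace G M) m v : EB) = 0) :
    ∃ ξ : EG, (infAction EG G m ξ : E) = v := by
  let T : E →L[ℝ] EB := mfderiv 𝓘(ℝ, E) 𝓘(ℝ, EB) (orbitProj G : M → OrbitSpace G M) m
  let ψ : EG →L[ℝ] E := infAction EG G m
  -- The connection form is a left inverse of the infinitesimal action.
  have hψ : Function.Injective (ψ : EG →ₗ[ℝ] E) :=
    Function.LeftInverse.injective (g := (A.form m : E →L[ℝ] EG)) (A.vertical m)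
  have hle : LinearMap.range (ψ : EG →ₗ[ℝ] E) ≤ T.ker := by
    rintro _ ⟨ξ, rfl⟩
    exact mfderiv_orbitProj_infAction hM hπ m ξ
  -- The fibre through `m` is the orbit, that is, the range of g ↦ m g. With `hle` and the
  -- injectivity of `ψ`, this bound forces the range of `ψ` to be the whole kernel.
  have hdim : Module.finrank ℝ T.ker ≤ Module.finrank ℝ EG := by
    refine finrank_ker_mfderiv_le hπ.smooth m rfl (hπ.submersion m) (o := fun g : G => m <• g)
      (hM.smooth.comp (f := fun g : G => (m, g)) (contMDiff_const.prodMk contMDiff_id)) ?_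
    intro x hx
    obtain ⟨k, hk⟩ : (MulAction.orbitRel Gᵐᵒᵖ M).r x m := Quotient.exact hx
    exact ⟨k.unop, hk⟩
  rw [← LinearMap.finrank_range_of_inj hψ] at hdim
  have h : v ∈ LinearMap.range (ψ : EG →ₗ[ℝ] E) := by
    rw [Submodule.eq_of_le_of_finrank_le hle hdim]
    exact hv
  exact h

/-- `ξ_M (m g) = T Ψ_g ((Ad_g ξ)_M (m))`. -/
theorem infAction_act [LieGroup 𝓘(ℝ, EG) ∞ G] (hM : IsFreeProperAction EG G E M) (g : G) (m : M)
    (ξ : EG) : (infAction EG G (m <• g) ξ : E) =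
      tangentAct (E := E) g m (infAction EG G m (Ad EG g ξ)) := by
  have hc : MDifferentiable 𝓘(ℝ, EG) 𝓘(ℝ, EG) (fun h : G => g * h * g⁻¹) :=
    ContMDiff.mdifferentiable (n := ∞)
      ((contMDiff_const.mul contMDiff_id).mul contMDiff_const) (by simp)
  -- (m g) h = (m (g h g⁻¹)) g; the claim is the chain rule for this identity at h = 1.
  have h1 : (fun h : G => (m <• g) <• h) =
      (fun x : M => x <• g) ∘ (fun h : G => m <• h) ∘ fun h : G => g * h * g⁻¹ := by
    funext h
    simp [← mul_smul, ← MulOpposite.op_mul, mul_assoc]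
  have h2 := mfderiv_comp (1 : G) (hM.mdifferentiable_orbit m (g * 1 * g⁻¹)) (hc 1)
  have h3 := mfderiv_comp (1 : G) (hM.mdifferentiable g (m <• (g * 1 * g⁻¹)))
    ((hM.mdifferentiable_orbit m (g * 1 * g⁻¹)).comp (1 : G) (hc 1))
  have h4 : (infAction EG G (m <• g) ξ : E) =
      tangentAct (E := E) g (m <• (g * 1 * g⁻¹))
        (mfderiv 𝓘(ℝ, EG) 𝓘(ℝ, E) (fun h : G => m <• h) (g * 1 * g⁻¹) (Ad EG g ξ) : E) := by
    unfold infAction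
    rw [h1]
    refine (congrArg (fun T : EG →L[ℝ] E => T ξ) h3).trans ?_
    exact congrArg (tangentAct (E := E) g (m <• (g * 1 * g⁻¹)) : E →L[ℝ] E)
      (congrArg (fun T : EG →L[ℝ] E => T ξ) h2)
  -- The chain rule produces the base point g 1 g⁻¹, equal to 1 only propositionally; generalizing
  -- it allows substitution in the dependent tangent spaces.
  have key : ∀ a : G, a = 1 → ∀ η : EG,
      (tangentAct (E := E) g (m <• a)
        (mfderiv 𝓘(ℝ, EG) 𝓘(ℝ, E) (fun h : G => m <• h) a η : E) : E) =
      tangentAct (E := E) g m (infAction EG G m η) := by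
    rintro _ rfl η
    have key' : ∀ m' : M, m' = m → ∀ w : E,
        (tangentAct (E := E) g m' w : E) = tangentAct (E := E) g m w := by
      rintro _ rfl w; rfl
    exact key' _ (by simp) _
  exact h4.trans (key _ (by simp) _)

end Actions

/-! ### Smoothness of `L` on fibres, and invariance of the momentum level sets under G_μ. -/

namespace InvariantSystem

variable {EG G EP EQ EF P Q F : Type*}
  [NormedAddCommGroup EG] [NormedSpace ℝ EG]
  [NormedAddCommGroup EP] [NormedSpace ℝ EP] [NormedAddCommGroup EQ] [NormedSpace ℝ EQ]
  [NormedAddCommGroup EF] [NormedSpace ℝ EF]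
  [TopologicalSpace G] [ChartedSpace EG G] [Group G]
  [TopologicalSpace P] [ChartedSpace EP P] [MulAction Gᵐᵒᵖ P]
  [TopologicalSpace Q] [ChartedSpace EQ Q] [IsManifold 𝓘(ℝ, EQ) ∞ Q] [MulAction Gᵐᵒᵖ Q]
  [TopologicalSpace F] [ChartedSpace EF F]
  (S : InvariantSystem EG G EP EQ EF P Q F)

/-- The Lagrangian on the fibre over `p`. -/
def fibreL (p : P) (v : EQ) : ℝ := S.L (FibredTangent.mk S.ε p v)

/-- In a trivialization of the pullback bundle the inclusion of a fibre is linear, hence smooth, and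
`L` is smooth on the total space. -/
theorem contDiff_fibreL (p : P) : ContDiff ℝ ∞ (S.fibreL p) := by
  have h : ContMDiff 𝓘(ℝ, EQ) (𝓘(ℝ, EP).prod 𝓘(ℝ, EQ)) ∞
      (fun v : EQ => (FibredTangent.mk S.ε p v : FibredTangent EQ (S.ε : P → Q))) := by
    intro v₀
    rw [Bundle.contMDiffAt_totalSpace]
    refine ⟨contMDiffAt_const, ?_⟩
    let e := trivializationAt EQ ((S.ε : P → Q) *ᵖ (TangentSpace 𝓘(ℝ, EQ) : Q → Type _)) p
    let l : EQ →L[ℝ] EQ := e.continuousLinearMapAt ℝ p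
    have h1 : (fun v : EQ => (e (FibredTangent.mk S.ε p v)).2) = l := by
      funext v
      exact (e.continuousLinearMapAt_apply_of_mem ℝ
        (FiberBundle.mem_baseSet_trivializationAt' p) v).symm
    have h2 : ContMDiff 𝓘(ℝ, EQ) 𝓘(ℝ, EQ) ∞ l := l.contMDiff
    exact (h1 ▸ h2) v₀
  exact (S.L_smooth.comp h).contDiff

/-- Transporting ξ_Q(q g) back by g⁻¹ gives (Ad_g ξ)_Q(q), so J_δ + δ transforms by Ad*_g. By
`isotropy_iff`, membership in G_μ says that μ + δ transforms in the same way. -/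
theorem J_cotangentLift [LieGroup 𝓘(ℝ, EG) ∞ G] (δ : P → LieAlgDual EG G)
    (μ : LieAlgDual EG G) {g : G} (hg : g ∈ isotropy δ μ) {α : S.Cot} (hα : S.J δ α = μ) :
    S.J δ (cotangentLift g α) = μ := by
  have h1 := (isotropy_iff δ μ g α.proj).1 (hg α.proj)
  refine ContinuousLinearMap.ext fun ξ => ?_
  have h2 : (tangentAct (E := EQ) g⁻¹ (S.ε (α.proj <• g))
      (infAction EG G (S.ε (α.proj <• g)) ξ : EQ) : EQ) =
      infAction EG G (S.ε α.proj) (Ad EG g ξ) := by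
    have key : ∀ q : Q, q = S.ε α.proj <• g →
        (infAction EG G q ξ : EQ) = infAction EG G (S.ε α.proj <• g) ξ := by
      rintro _ rfl; rfl
    have h3 := (key _ (S.ε_equivariant g α.proj)).trans (infAction_act S.actQ g (S.ε α.proj) ξ)
    refine (congrArg (tangentAct (E := EQ) g⁻¹ (S.ε (α.proj <• g)) : EQ →L[ℝ] EQ) h3).trans ?_
    exact (S.tangentActEquiv g α.proj).symm_apply_apply _
  have h4 : S.J δ (cotangentLift g α) ξ =
      α.cov (infAction EG G (S.ε α.proj) (Ad EG g ξ)) - δ (α.proj <• g) ξ :=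
    congrArg (fun w : EQ => (α.cov : EQ →L[ℝ] ℝ) w - δ (α.proj <• g) ξ) h2
  have h5 : α.cov (infAction EG G (S.ε α.proj) (Ad EG g ξ)) - δ α.proj (Ad EG g ξ) =
      μ (Ad EG g ξ) := congrArg (fun ν : LieAlgDual EG G => ν (Ad EG g ξ)) hα
  have h6 : μ ξ + δ (α.proj <• g) ξ = μ (Ad EG g ξ) + δ α.proj (Ad EG g ξ) :=
    congrArg (fun ν : LieAlgDual EG G => ν ξ) h1
  rw [h4]
  linarith

theorem tangentLift_mem_levelTan [LieGroup 𝓘(ℝ, EG) ∞ G] (δ : P → LieAlgDual EG G)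
    (μ : LieAlgDual EG G) {g : G} (hg : g ∈ isotropy δ μ) {x : S.Tan} (hx : x ∈ S.levelTan δ μ) :
    tangentLift g x ∈ S.levelTan δ μ := by
  change S.J δ (fibreDerivative S.L (tangentLift g x)) = μ
  rw [S.legendre_equivariant]
  exact S.J_cotangentLift δ μ hg hx

end InvariantSystem

/-! ### Covectors on Q/G as classes of covectors that annihilate vertical vectors. -/

/-- A functional that vanishes on the kernel of a surjective linear map factors through it. -/
theorem exists_comp_eq_of_ker_le {EQ EB : Type*} [NormedAddCommGroup EQ] [NormedSpace ℝ EQ]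
    [NormedAddCommGroup EB] [NormedSpace ℝ EB] [FiniteDimensional ℝ EB] (T : EQ →L[ℝ] EB)
    (hT : Function.Surjective T) (a : EQ →L[ℝ] ℝ) (ha : ∀ v, T v = 0 → a v = 0) :
    ∃ β : EB →L[ℝ] ℝ, β.comp T = a := by
  obtain ⟨R, hR⟩ := T.exists_rightInverse_of_surjective (LinearMap.range_eq_top.2 hT)
  have hR' : ∀ w, T (R w) = w := fun w => congrArg (fun R : EB →L[ℝ] EB => R w) hR
  refine ⟨a.comp R, ContinuousLinearMap.ext fun v => ?_⟩
  have h : a (R (T v) - v) = 0 := ha _ (by rw [map_sub, hR', sub_self])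
  rw [map_sub, sub_eq_zero] at h
  exact h

namespace InvariantSystem

variable {EG G EP EQ EF EB P Q F : Type*}
  [NormedAddCommGroup EG] [NormedSpace ℝ EG]
  [NormedAddCommGroup EP] [NormedSpace ℝ EP]
  [NormedAddCommGroup EQ] [NormedSpace ℝ EQ]
  [NormedAddCommGroup EF] [NormedSpace ℝ EF]
  [NormedAddCommGroup EB] [NormedSpace ℝ EB]
  [TopologicalSpace G] [ChartedSpace EG G] [Group G] [LieGroup 𝓘(ℝ, EG) ∞ G]
  [TopologicalSpace P] [ChartedSpace EP P] [MulAction Gᵐᵒᵖ P]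
  [TopologicalSpace Q] [ChartedSpace EQ Q] [IsManifold 𝓘(ℝ, EQ) ∞ Q] [MulAction Gᵐᵒᵖ Q]
  [TopologicalSpace F] [ChartedSpace EF F]
  [ChartedSpace EB (OrbitSpace G Q)]
  (hπ : IsQuotientStructure G EQ Q EB) (S : InvariantSystem EG G EP EQ EF P Q F)
  (δ : P → LieAlgDual EG G) (μ : LieAlgDual EG G) (A : PrincipalConnection EG G EQ Q)

theorem baseCot_ext {x y : S.BaseCot δ μ EB} (h : x.proj = y.proj)
    (h' : (x.cov : EB →L[ℝ] ℝ) = (y.cov : EB →L[ℝ] ℝ)) : x = y := by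
  obtain ⟨p, v⟩ := x
  obtain ⟨p', v'⟩ := y
  obtain rfl : p = p' := h
  obtain rfl : v = v' := h'
  rfl

include hπ in
theorem tangentProj_surjective (p : P) (w : EB) :
    ∃ v : EQ, (S.tangentProj δ μ EB p v : EB) = w :=
  hπ.submersion (S.ε p) w

include hπ in
theorem tangentProj_infAction (p : P) (ξ : EG) :
    (S.tangentProj δ μ EB p (infAction EG G (S.ε p) ξ) : EB) = 0 :=
  mfderiv_orbitProj_infAction S.actQ hπ (S.ε p) ξ

/-- Equal classes have representatives over p and p g with g in G_μ. Since T_{qg}π ∘ TΨ_g = T_qπ,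
the covectors on Q/G agree after composition with the surjective map T_qπ, so they agree. -/
theorem cotId_injective : Function.Injective (S.cotId δ μ hπ) := by
  rintro ⟨c, β⟩ ⟨c', β'⟩ h
  obtain ⟨p, rfl⟩ := Quotient.exists_rep c
  obtain ⟨p', rfl⟩ := Quotient.exists_rep c'
  have h1 := ((S.cotId_mk δ μ hπ p β).symm.trans h).trans (S.cotId_mk δ μ hπ p' β')
  obtain ⟨g, hg, hgp⟩ := Quotient.exact h1
  obtain rfl : p <• g = p' := congrArg FibredCotangent.proj hgp
  refine S.baseCot_ext δ μ (projP_act δ μ hg p).symm (ContinuousLinearMap.ext fun w => ?_)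
  obtain ⟨v, rfl⟩ := S.tangentProj_surjective hπ δ μ p w
  injection hgp with _ hcov
  have h2 : (β : EB →L[ℝ] ℝ) (S.tangentProj δ μ EB p (tangentAct (E := EQ) g⁻¹ (S.ε (p <• g))
      (S.tangentActEquiv g p v) : EQ) : EB) =
      (β' : EB →L[ℝ] ℝ) (S.tangentProj δ μ EB (p <• g) (S.tangentActEquiv g p v) : EB) :=
    congrArg (fun l : EQ →L[ℝ] ℝ => l (S.tangentActEquiv g p v)) hcov
  have h3 : (tangentAct (E := EQ) g⁻¹ (S.ε (p <• g)) (S.tangentActEquiv g p v) : EQ) = v :=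
    (S.tangentActEquiv g p).symm_apply_apply v
  have h4 := congrArg (β' : EB →L[ℝ] ℝ) (S.tangentProj_act δ μ hπ g p v)
  have h5 := congrArg (fun u : EQ => (β : EB →L[ℝ] ℝ) (S.tangentProj δ μ EB p u : EB)) h3
  exact h5.symm.trans (h2.trans h4)

section Vertical

-- Supplied in the main theorem by `exists_infAction_eq`.
variable (hver : ∀ (p : P) (v : EQ), (S.tangentProj δ μ EB p v : EB) = 0 →
    ∃ ξ : EG, (infAction EG G (S.ε p) ξ : EQ) = v)

include hver

theorem exists_pullback_eq [FiniteDimensional ℝ EB] (α : S.annihilator) :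
    ∃ β : EB →L[ℝ] ℝ, S.pullbackCov δ μ hπ α.1.proj β = α := by
  let T : EQ →L[ℝ] EB := S.tangentProj δ μ EB α.1.proj
  let a : EQ →L[ℝ] ℝ := α.1.cov
  obtain ⟨β, hβ⟩ := exists_comp_eq_of_ker_le T (S.tangentProj_surjective hπ δ μ α.1.proj) a (by
      intro v hv
      obtain ⟨ξ, hξ⟩ := hver _ v hv
      exact (congrArg a hξ).symm.trans (α.2 ξ))
  exact ⟨β, Subtype.ext (S.cot_ext rfl hβ)⟩

theorem cotId_surjective [FiniteDimensional ℝ EB] : Function.Surjective (S.cotId δ μ hπ) := by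
  intro y
  obtain ⟨α, rfl⟩ := Quotient.exists_rep y
  obtain ⟨β, hβ⟩ := S.exists_pullback_eq hπ δ μ hver α
  exact ⟨⟨projP δ μ α.1.proj, β⟩, (S.cotId_mk δ μ hπ α.1.proj β).trans (congrArg _ hβ)⟩

/-! ### Regularity: the level set as a section of T_qπ, and bijectivity of Π_μ. -/

variable (hreg : S.IsGRegular δ)

include hreg

/-- The difference v' - v is vertical, say ξ_Q(q), and the injective map η ↦ J_{L,δ}(v + η_Q(q), p)
takes the value μ at both 0 and ξ. -/
theorem levelTan_unique (p : P) (v v' : EQ)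
    (hv : FibredTangent.mk (S.ε : P → Q) p v ∈ S.levelTan δ μ)
    (hv' : FibredTangent.mk (S.ε : P → Q) p v' ∈ S.levelTan δ μ)
    (h : (S.tangentProj δ μ EB p v : EB) = S.tangentProj δ μ EB p v') : v = v' := by
  obtain ⟨ξ, hξ⟩ := hver p (v' - v)
    ((map_sub (S.tangentProj δ μ EB p : EQ →L[ℝ] EB) v' v).trans (sub_eq_zero.2 h.symm))
  obtain ⟨Φ, hΦ⟩ := hreg (FibredTangent.mk S.ε p v)
  let ψ : EG →L[ℝ] EQ := infAction EG G (S.ε p)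
  have key : ∀ η : EG, ∀ u : EQ, v + ψ η = u →
      FibredTangent.mk (S.ε : P → Q) p u ∈ S.levelTan δ μ → Φ η = μ := by
    rintro η _ rfl hu
    exact (hΦ η).trans hu
  have hξ' : ψ ξ = v' - v := hξ
  have h1 : ξ = 0 := Φ.injective
    ((key ξ v' (by rw [hξ']; abel) hv').trans (key 0 v (by rw [map_zero, add_zero]) hv).symm)
  rw [h1, map_zero] at hξ'
  exact (sub_eq_zero.1 hξ'.symm).symm

omit hver in
include hπ in
theorem exists_levelTan (p : P) (w : EB) : ∃ v : EQ, (S.tangentProj δ μ EB p v : EB) = w ∧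
    FibredTangent.mk (S.ε : P → Q) p v ∈ S.levelTan δ μ := by
  obtain ⟨v, rfl⟩ := S.tangentProj_surjective hπ δ μ p w
  obtain ⟨Φ, hΦ⟩ := hreg (FibredTangent.mk S.ε p v)
  let ψ : EG →L[ℝ] EQ := infAction EG G (S.ε p)
  -- Correct any lift of `w` by the vertical vector that brings its momentum to μ.
  refine ⟨v + ψ (Φ.symm μ), ?_, ?_⟩
  · refine (map_add (S.tangentProj δ μ EB p : EQ →L[ℝ] EB) _ _).trans ?_
    exact (congrArg _ (S.tangentProj_infAction hπ δ μ p _)).trans (add_zero _)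
  · exact (hΦ (Φ.symm μ)).symm.trans (Φ.apply_symm_apply μ)

/-- An element of G_μ moves one representative over the base point of the other. It stays in the
level set by `tangentLift_mem_levelTan`, and there `levelTan_unique` applies. -/
theorem Pi_injective : Function.Injective (S.Pi δ μ hπ) := by
  intro x y h
  obtain ⟨⟨⟨p, v⟩, hx⟩, rfl⟩ := Quotient.exists_rep x
  obtain ⟨⟨⟨p', v'⟩, hy⟩, rfl⟩ := Quotient.exists_rep y
  have h1 : projP δ μ p' = projP δ μ p := congrArg Bundle.TotalSpace.proj h.symm
  obtain ⟨⟨k, hk⟩, hkp⟩ : (MulAction.orbitRel (isotropy (P := P) δ μ).op P).r p' p :=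
    Quotient.exact h1
  obtain rfl : p <• k.unop = p' := hkp
  refine Quotient.sound ⟨k.unop, hk, ?_⟩
  refine S.tan_ext rfl ?_
  refine S.levelTan_unique δ μ hver hreg (p <• k.unop) _ _
    (S.tangentLift_mem_levelTan δ μ hk hx) hy ?_
  refine (S.tangentProj_act δ μ hπ k.unop p v).trans ?_
  have key : ∀ {a b : S.BaseTan δ μ EB}, a = b → (a.vec : EB) = (b.vec : EB) := by
    rintro a _ rfl; rfl
  exact key h

omit hver in
theorem Pi_surjective : Function.Surjective (S.Pi δ μ hπ) := by
  rintro ⟨c, w⟩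
  obtain ⟨p, rfl⟩ := Quotient.exists_rep c
  obtain ⟨v, hv, hl⟩ := S.exists_levelTan hπ δ μ hreg p w
  exact ⟨Quotient.mk _ ⟨_, hl⟩, S.baseTan_ext δ μ rfl hv⟩

/-! ### The fibre derivative of the Routhian. -/

variable [FiniteDimensional ℝ EG] [FiniteDimensional ℝ EB]

/-- The derivative of the Routhian along the fibres is the covector that pulls back to
`𝔽L - ⟨μ + δ, 𝒜⟩`. -/
theorem hasFDerivAt_routhian {Δ : S.BaseTan δ μ EB → S.RedTan δ μ}
    (hΔ : ∀ y, Δ (S.Pi δ μ hπ y) = y) (x : S.levelTan δ μ) (β : EB →L[ℝ] ℝ)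
    (hβ : ∀ v : EQ, β (S.tangentProj δ μ EB x.1.proj v) =
      (fibreDerivative S.L x.1).cov v - S.shiftCov δ μ A x.1.proj v) :
    HasFDerivAt (fun w : EB => S.routhian δ μ A Δ
      (FibredTangent.mk (S.εRed δ μ) (projP δ μ x.1.proj) w)) β
      (S.tangentProj δ μ EB x.1.proj x.1.vec) := by
  obtain ⟨⟨p, (v : EQ)⟩, hx⟩ := x
  let T : EQ →L[ℝ] EB := S.tangentProj δ μ EB p
  let ψ : EG →L[ℝ] EQ := infAction EG G (S.ε p)
  have hL := S.contDiff_fibreL p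
  choose s hs hsl using S.exists_levelTan hπ δ μ hreg p
  have hsd : Differentiable ℝ s := by
    refine differentiable_of_fibrewise_diffeomorph T (S.tangentProj_surjective hπ δ μ p) ψ
      -- This function is J_{L,δ} on the fibre over `p`.
      (hver p) (fun u => (fderiv ℝ (S.fibreL p) u).comp ψ - δ p) ?_
      (fun u => hreg (FibredTangent.mk S.ε p u)) μ s hs hsl
    have h1 : ContDiff ℝ 1 (fderiv ℝ (S.fibreL p)) := hL.fderiv_right (by norm_cast)
    exact (h1.clm_comp contDiff_const).sub contDiff_const
  -- The chosen section passes through the given vector, because the level set meets each coset only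
  -- once.
  have hsv : s (T v) = v :=
    S.levelTan_unique δ μ hver hreg p _ _ (hsl _) hx (hs _)
  let a : EQ →L[ℝ] ℝ := S.shiftCov δ μ A p
  let R : EQ → ℝ := fun u => S.fibreL p u - a u
  -- As `Δ` inverts `Pi`, it sends (w, [p]) to the class of the level vector `s w`.
  have hfun : (fun w : EB => S.routhian δ μ A Δ
      (FibredTangent.mk (S.εRed δ μ) (projP δ μ p) w)) = fun w => R (s w) := by
    funext w
    have h1 : S.Pi δ μ hπ (Quotient.mk _ ⟨_, hsl w⟩) =
        FibredTangent.mk (S.εRed δ μ) (projP δ μ p) w := S.baseTan_ext δ μ rfl (hs w)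
    unfold routhian
    rw [← h1, hΔ]
    rfl
  have hR : HasFDerivAt R (β.comp T) (s (T v)) := by
    have h2 : HasFDerivAt (S.fibreL p) (fderiv ℝ (S.fibreL p) v) v :=
      (hL.differentiable (by simp) v).hasFDerivAt
    have h3 : HasFDerivAt R (fderiv ℝ (S.fibreL p) v - a) v := h2.sub a.hasFDerivAt
    have h4 : β.comp T = fderiv ℝ (S.fibreL p) v - a :=
      ContinuousLinearMap.ext hβ
    rw [hsv, h4]
    exact h3
  have h := hasFDerivAt_comp_section (T := T) hs hsd hR
  rw [← hfun] at h
  exact h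

end Vertical

end InvariantSystem

end Routh

end

/-! ### The Legendre transform and the energy of the Routhian. -/

theorem lemma5p9 {EG G EP EQ EF EB P Q F : Type*}
    [NormedAddCommGroup EG] [NormedSpace ℝ EG] [FiniteDimensional ℝ EG]
    [NormedAddCommGroup EP] [NormedSpace ℝ EP] [FiniteDimensional ℝ EP]
    [NormedAddCommGroup EQ] [NormedSpace ℝ EQ] [FiniteDimensional ℝ EQ]
    [NormedAddCommGroup EF] [NormedSpace ℝ EF] [FiniteDimensional ℝ EF]
    [NormedAddCommGroup EB] [NormedSpace ℝ EB] [FiniteDimensional ℝ EB]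
    -- the Lie group `G`
    [TopologicalSpace G] [ChartedSpace EG G] [Group G] [LieGroup 𝓘(ℝ, EG) ∞ G]
    [T2Space G] [SecondCountableTopology G]
    -- the manifolds `P` and `Q`, with right actions of `G`, and the typical fibre `F` of `P → Q`
    [TopologicalSpace P] [ChartedSpace EP P] [IsManifold 𝓘(ℝ, EP) ∞ P]
    [T2Space P] [SecondCountableTopology P] [MulAction Gᵐᵒᵖ P]
    [TopologicalSpace Q] [ChartedSpace EQ Q] [IsManifold 𝓘(ℝ, EQ) ∞ Q]
    [T2Space Q] [SecondCountableTopology Q] [MulAction Gᵐᵒᵖ Q]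
    [TopologicalSpace F] [ChartedSpace EF F] [IsManifold 𝓘(ℝ, EF) ∞ F]
    [T2Space F] [SecondCountableTopology F]
    -- the quotient manifold `Q/G`
    [ChartedSpace EB (Routh.OrbitSpace G Q)] [IsManifold 𝓘(ℝ, EB) ∞ (Routh.OrbitSpace G Q)]
    (hπ : Routh.IsQuotientStructure G EQ Q EB)
    -- the invariant magnetic Lagrangian system `(ε : P → Q, L, B)`
    (S : Routh.InvariantSystem EG G EP EQ EF P Q F)
    -- the `B𝔤`-potential `δ`, `G`-regularity, the momentum `μ` and the connection `𝒜`
    (δ : P → Routh.LieAlgDual EG G) (hδ : S.IsBgPotential δ) (hreg : S.IsGRegular δ)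
    (μ : Routh.LieAlgDual EG G)
    (A : Routh.PrincipalConnection EG G EQ Q) :
    -- `T*_{P/G_μ} (Q/G) = V⁰_P π / G_μ`, and `Π_μ` is invertible, with inverse `Δ_μ`
    ∃ (hκ : Function.Bijective (S.cotId δ μ hπ)) (h_bij : Function.Bijective (S.Pi δ μ hπ)),
      let κ : S.BaseCot δ μ EB ≃ S.RedAnn δ μ := Equiv.ofBijective _ hκ
      let Δ : S.BaseTan δ μ EB ≃ S.RedTan δ μ := (Equiv.ofBijective _ h_bij).symm
      let Lt : S.BaseTan δ μ EB → ℝ := S.routhian δ μ A Δ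
      Routh.FibrewiseDifferentiable Lt ∧
      Routh.fibreDerivative Lt = κ.symm ∘ S.redShift δ μ A ∘ S.redLegendre δ μ ∘ Δ ∧
      ∀ x : S.levelTan δ μ,
        Routh.energy Lt (S.Pi δ μ hπ (S.projTan δ μ x)) = Routh.energy S.L x.1 := by
  have hver : ∀ (p : P) (v : EQ), (S.tangentProj δ μ EB p v : EB) = 0 →
      ∃ ξ : EG, (Routh.infAction EG G (S.ε p) ξ : EQ) = v := fun p v hv =>
    Routh.exists_infAction_eq S.actQ hπ A (S.ε p) v hv
  have hκ : Function.Bijective (S.cotId δ μ hπ) :=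
    ⟨S.cotId_injective hπ δ μ, S.cotId_surjective hπ δ μ hver⟩
  have h_bij : Function.Bijective (S.Pi δ μ hπ) :=
    ⟨S.Pi_injective hπ δ μ hver hreg, S.Pi_surjective hπ δ μ hreg⟩
  refine ⟨hκ, h_bij, ?_⟩
  intro κ Δ Lt
  have hΔ : ∀ y, Δ (S.Pi δ μ hπ y) = y := (Equiv.ofBijective _ h_bij).symm_apply_apply
  -- The shifted Legendre covector annihilates vertical vectors, so it descends to a covector β on
  -- Q/G. All three claims are read off from this β.
  have hβ : ∀ x : S.levelTan δ μ, ∃ β : EB →L[ℝ] ℝ,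
      S.pullbackCov δ μ hπ x.1.proj β = S.shift δ μ A ⟨Routh.fibreDerivative S.L x.1, x.2⟩ :=
    fun x =>
      S.exists_pullback_eq hπ δ μ hver (S.shift δ μ A ⟨Routh.fibreDerivative S.L x.1, x.2⟩)
  have hβ' : ∀ (x : S.levelTan δ μ) (β : EB →L[ℝ] ℝ),
      S.pullbackCov δ μ hπ x.1.proj β = S.shift δ μ A ⟨Routh.fibreDerivative S.L x.1, x.2⟩ →
      ∀ v : EQ, β (S.tangentProj δ μ EB x.1.proj v) =
        (Routh.fibreDerivative S.L x.1).cov v - S.shiftCov δ μ A x.1.proj v := by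
    intro x β h v
    have h1 := congrArg Subtype.val h
    injection h1 with _ h2
    exact congrArg (fun l : EQ →L[ℝ] ℝ => l v) h2
  have hderiv : ∀ (x : S.levelTan δ μ) (β : EB →L[ℝ] ℝ),
      S.pullbackCov δ μ hπ x.1.proj β = S.shift δ μ A ⟨Routh.fibreDerivative S.L x.1, x.2⟩ →
      HasFDerivAt (fun w : EB => Lt (Routh.FibredTangent.mk (S.εRed δ μ)
        (Routh.InvariantSystem.projP δ μ x.1.proj) w)) β
        (S.tangentProj δ μ EB x.1.proj x.1.vec) := fun x β h =>
    S.hasFDerivAt_routhian hπ δ μ A hver hreg hΔ x β (hβ' x β h)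
  have hfib : ∀ (x : S.levelTan δ μ) (β : EB →L[ℝ] ℝ),
      S.pullbackCov δ μ hπ x.1.proj β = S.shift δ μ A ⟨Routh.fibreDerivative S.L x.1, x.2⟩ →
      Routh.fibreDerivative Lt (S.Pi δ μ hπ (S.projTan δ μ x)) =
        ⟨Routh.InvariantSystem.projP δ μ x.1.proj, β⟩ :=
    fun x β h => S.baseCot_ext δ μ rfl (hderiv x β h).fderiv
  refine ⟨?_, ?_, ?_⟩
  · intro c w
    obtain ⟨p, rfl⟩ := Quotient.exists_rep c
    obtain ⟨v, rfl, hl⟩ := S.exists_levelTan hπ δ μ hreg p w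
    obtain ⟨β, h⟩ := hβ ⟨_, hl⟩
    exact (hderiv ⟨_, hl⟩ β h).differentiableAt
  · funext z
    obtain ⟨y, rfl⟩ := h_bij.2 z
    obtain ⟨x, rfl⟩ := Quotient.exists_rep y
    obtain ⟨β, h⟩ := hβ x
    -- Compare in V⁰_P π / G_μ instead: applying κ to the fibre derivative ([p], β) gives the class
    -- of β ∘ T_qπ, which is the shifted covector by the choice of β.
    refine ((Equiv.symm_apply_eq κ).2 ?_).symm
    refine (congrArg (fun y => S.redShift δ μ A (S.redLegendre δ μ y)) (hΔ _)).trans ?_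
    refine Eq.trans ?_ (congrArg κ (hfib x β h)).symm
    refine Eq.trans ?_ (S.cotId_mk δ μ hπ x.1.proj β).symm
    exact congrArg (Quotient.mk _) h.symm
  · intro x
    obtain ⟨β, h⟩ := hβ x
    have h1 : Routh.energy Lt (S.Pi δ μ hπ (S.projTan δ μ x)) =
        β (S.tangentProj δ μ EB x.1.proj x.1.vec) - Lt (S.Pi δ μ hπ (S.projTan δ μ x)) :=
      congrArg (fun l : EB →L[ℝ] ℝ => l (S.tangentProj δ μ EB x.1.proj x.1.vec) -
        Lt (S.Pi δ μ hπ (S.projTan δ μ x))) (hderiv x β h).fderiv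
    have h2 : Lt (S.Pi δ μ hπ (S.projTan δ μ x)) =
        S.L x.1 - S.shiftCov δ μ A x.1.proj x.1.vec :=
      congrArg (S.redLagrangian δ μ A) (hΔ (S.projTan δ μ x))
    have h3 := hβ' x β h x.1.vec
    have h4 : Routh.energy S.L x.1 = (Routh.fibreDerivative S.L x.1).cov x.1.vec - S.L x.1 := rfl
    rw [h1, h2, h4]
    refine (congrArg (fun r => r - (S.L x.1 - S.shiftCov δ μ A x.1.proj x.1.vec)) h3).trans ?_
    -- With a = ⟨μ + δ(p), 𝒜(q)(v)⟩: (𝔽L(v) - a) - (L - a) = 𝔽L(v) - L.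
    exact sub_sub_sub_cancel_right _ _ _
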